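/- **Theorem 1.3.** Let $K\subset\mathbb{C}$ be an imaginary quadratic number field with discriminant $D_K$ whose ring of integers $\mathcal{O}_K$ is principal. For a nonzero ideal $\mathfrak{a}$ of $\mathcal{O}_K$ let $N(\mathfrak{a})=\operatorname{Card}(\mathcal{O}_K/\mathfrak{a})$ and $\varphi_K(\mathfrak{a})=\operatorname{Card}((\mathcal{O}_K/\mathfrak{a})^\times)$; put $\varphi_K(a)=\varphi_K(a\mathcal{O}_K)$ for $a\in\mathcal{O}_K\smallsetminus\{0\}$ and, by convention, $\varphi_K(0)=0$. For $z\in\mathbb{C}^\times$, $\theta\in\,]0,2\pi]$ and $x\ge 0$, let $$C(z,\theta,x)=\Big\{\rho e^{it}z \;:\; t\in\,\Big]-\frac{\theta}{2},\frac{\theta}{2}\Big],\ 0<\rho\le\frac{x}{|z|}\Big\}.$$ Then for all $z\in\mathbb{C}^\times$, $\theta\in\,]0,2\pi]$ and $k\in\mathcal{O}_K$, the sets $\mathcal{O}_K\cap C(z,\theta,x)$ are finite, the two products below converge unconditionally, and, as $x\to+\infty$, $$\sum_{a\in\mathcal{O}_K\cap C(z,\theta,x)}\varphi_K(a)\,\varphi_K(a+k)\;\sim\;\frac{\theta}{3\sqrt{|D_K|}}\;\prod_{\mathfrak{p}}\Big(1-\frac{2}{N(\mathfrak{p})^2}\Big)\prod_{\mathfrak{p}\mid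 k\mathcal{O}_K}\Big(1+\frac{1}{N(\mathfrak{p})\,(N(\mathfrak{p})^2-2)}\Big)\;x^6,$$ where $\mathfrak{p}$ ranges over the nonzero prime ideals of $\mathcal{O}_K$ (when $k=0$, every $\mathfrak{p}$ divides $k\mathcal{O}_K$). -/

import Mathlib

open scoped NumberField

namespace SectorialMirsky

/-- The truncated angular sector
`C(z, θ, R) = {ρ e^{it} z : t ∈ ]-θ/2, θ/2], 0 < ρ ≤ R / |z|}` in `ℂ`. -/
def sector (z : ℂ) (θ R : ℝ) : Set ℂ :=
  {w | ∃ t ρ : ℝ, -(θ / 2) < t ∧ t ≤ θ / 2 ∧ 0 < ρ ∧ ρ ≤ R / ‖z‖ ∧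
    w = (ρ : ℂ) * Complex.exp (t * Complex.I) * z}

open Classical in
/-- The Euler function of `K` on ideals: `φ_K(𝔞) = Card ((𝓞_K / 𝔞)ˣ)` for every nonzero
ideal `𝔞`, with the convention `φ_K(0) = 0`. -/
noncomputable def eulerPhi (K : Type*) [Field K] (𝔞 : Ideal (𝓞 K)) : ℕ :=
  if 𝔞 = ⊥ then 0 else Nat.card (𝓞 K ⧸ 𝔞)ˣ

/-- `φ_K(a) = φ_K(a 𝓞_K)` for `a ∈ 𝓞_K`. -/
noncomputable def eulerPhiElem (K : Type*) [Field K] (a : 𝓞 K) : ℕ :=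
  eulerPhi K (Ideal.span {a})

/-- `𝓞_K ∩ C(z, θ, x)`, where `K` is seen as a subfield of `ℂ` through `σ`. -/
def sectorIntegers (K : Type*) [Field K] (σ : K →+* ℂ) (z : ℂ) (θ x : ℝ) : Set (𝓞 K) :=
  {a | σ (a : K) ∈ sector z θ x}

/-- The nonzero prime ideals of `𝓞_K` dividing `k 𝓞_K` (all of them when `k = 0`). -/
abbrev PrimeDivisor (K : Type*) [Field K] (k : 𝓞 K) : Type _ :=
  {𝔭 : IsDedekindDomain.HeightOneSpectrum (𝓞 K) // 𝔭.asIdeal ∣ Ideal.span {k}}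

/-- The local factor `1 - 2 / N(𝔭)²`. -/
noncomputable def mainFactor (K : Type*) [Field K] [NumberField K]
    (𝔭 : IsDedekindDomain.HeightOneSpectrum (𝓞 K)) : ℝ :=
  1 - 2 / (Ideal.absNorm 𝔭.asIdeal : ℝ) ^ 2

/-- The local factor `1 + 1 / (N(𝔭) (N(𝔭)² - 2))`. -/
noncomputable def divisorFactor (K : Type*) [Field K] [NumberField K]
    (𝔭 : IsDedekindDomain.HeightOneSpectrum (𝓞 K)) : ℝ :=
  1 + 1 / ((Ideal.absNorm 𝔭.asIdeal : ℝ) * ((Ideal.absNorm 𝔭.asIdeal : ℝ) ^ 2 - 2))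

end SectorialMirsky

/-!
Write `N(a)` for the norm of `a`, which is `‖σ a‖ ^ 2` since `K` is imaginary quadratic. For
`a ≠ 0` the quotient `φ_K(a) / N(a)` is the Euler product of the factors `1 - 1 / N(p)` over the
primes `p` dividing `a` (`eulerPhiElem_eq_truncRatio`), and the proof compares it with its
truncation `truncRatio s a` to a finite set `s` of primes.

* *Truncated sums.* `truncRatio s a * truncRatio s (a + k)` depends only on `a` modulo the product
  of the primes of `s`, which is a principal ideal `(m)`. The points of a residue class modulo `m`
  lying in the sector, weighted by `N(a) N(a + k)`, form a Riemann sum over a translated lattice,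
  so their contribution is asymptotic to `θ / (3 √|D_K| N(m)) * x ^ 6`
  (`tendsto_sum_sector_coset`). The mean value of the periodic factor is computed prime by prime
  by the Chinese remainder theorem (`sum_truncRatio_quotient`); this gives
  `tendsto_truncated_sum`.
* *Truncation error.* Since `truncRatio s a - φ_K(a) / N(a)` is at most the sum of `1 / N(p)` over
  the primes `p ∉ s` dividing `a`, and since a principal prime `p` contains `O(x ^ 2 / N(p))`
  nonzero elements of modulus at most `x`, the error is at most
  `O(x ^ 6) * ∑ p ∉ s, 1 / N(p) ^ 2`, uniformly in `s`
  (`exists_sum_eulerPhi_sub_truncated_le`).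
* *Conclusion.* The series `∑ 1 / N(p) ^ 2` converges, because primes inject into the lattice of
  integers through their generators (`summable_inv_absNorm_sq`). Hence the Euler products converge
  to nonzero limits, and letting `s` grow gives the asymptotic formula (`tendsto_sum_eulerPhi`).

The Riemann sum argument (`tendsto_tsum_lattice_div_sq`) writes a sum over a translated lattice as
the integral of a step function, to which dominated convergence applies. It needs the test function
to be continuous only almost everywhere, so that sharp sectors are allowed.
-/

namespace SectorialMirsky

open MeasureTheory Filter Topology Module Submodule

/-! ### Riemann sums over translated lattices in the complex plane -/

theorem measurable_coe_floor (B : Basis (Fin 2) ℝ ℂ) :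
    Measurable fun v : ℂ => (ZSpan.floor B v : ℂ) := by
  have h : (fun v : ℂ => (ZSpan.floor B v : ℂ)) =
      fun v => ∑ i, ((⌊B.repr v i⌋ : ℤ) : ℝ) • B i := by
    funext v
    simp [ZSpan.floor]
  rw [h]
  refine Finset.measurable_sum _ fun i _ => Measurable.smul_const ?_ _
  have hc : Continuous fun v : ℂ => B.repr v i :=
    (B.coord i).continuous_of_finiteDimensional
  exact (measurable_from_top (f := fun n : ℤ => (n : ℝ))).comp
    (Int.measurable_floor.comp hc.measurable)

theorem coe_floor_vadd (B : Basis (Fin 2) ℝ ℂ) (b : span ℤ (Set.range B)) {v : ℂ}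
    (hv : v ∈ ZSpan.fundamentalDomain B) : (ZSpan.floor B (b +ᵥ v) : ℂ) = b := by
  have h1 : ZSpan.fract B ((b : ℂ) + v) = v := by
    rw [ZSpan.fract_zSpan_add _ _ b.2, ZSpan.fract_eq_self.2 hv]
  rw [ZSpan.fract_apply] at h1
  have h2 : (b +ᵥ v : ℂ) = (b : ℂ) + v := rfl
  rw [h2]
  linear_combination -h1

/-- Integrating a function of the lattice point of the cell of `v` amounts to summing over the
lattice. -/
theorem integral_comp_floor (B : Basis (Fin 2) ℝ ℂ) (g : ℂ → ℝ)
    (hg : Integrable fun v => g (ZSpan.floor B v)) :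
    ∫ v, g (ZSpan.floor B v) =
      volume.real (ZSpan.fundamentalDomain B) * ∑' b : span ℤ (Set.range B), g b := by
  have : VAddInvariantMeasure (span ℤ (Set.range B)) ℂ volume :=
    ⟨fun c s _ => measure_preimage_add volume (c : ℂ) s⟩
  rw [(ZSpan.isAddFundamentalDomain B volume).integral_eq_tsum'' _ hg, ← tsum_mul_left]
  refine tsum_congr fun b => ?_
  rw [setIntegral_congr_fun (g := fun _ => g b)
    (ZSpan.fundamentalDomain_measurableSet B) fun v hv => by
      simp only []; rw [coe_floor_vadd B b hv]]
  simp

/-- Riemann sums over the lattice spanned by `B`, translated by `w₀` and rescaled by `1 / x`. The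
test function `h x` may depend on the scale; the hypothesis `hlim` on its limit `h₀` combines
almost everywhere continuity of `h₀` with a local uniformity of the convergence. -/
theorem tendsto_tsum_lattice_div_sq (B : Basis (Fin 2) ℝ ℂ) (w₀ : ℂ) (h : ℝ → ℂ → ℝ)
    (h₀ : ℂ → ℝ) (hm : ∀ x, Measurable (h x)) (M R : ℝ)
    (hR : ∀ᶠ x in atTop, ∀ w, R < ‖w‖ → h x w = 0)
    (hM : ∀ᶠ x in atTop, ∀ w, |h x w| ≤ M)
    (hlim : ∀ᵐ u, ∀ v : ℝ → ℂ, Tendsto v atTop (𝓝 u) →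
      Tendsto (fun x => h x (v x)) atTop (𝓝 (h₀ u))) :
    Tendsto (fun x : ℝ => (∑' b : span ℤ (Set.range B), h x ((x : ℂ)⁻¹ * (b + w₀))) / x ^ 2)
      atTop (𝓝 ((∫ u, h₀ u) / volume.real (ZSpan.fundamentalDomain B))) := by
  set V := volume.real (ZSpan.fundamentalDomain B) with hV
  have hV0 : V ≠ 0 := by
    have h1 := ZSpan.measure_fundamentalDomain_ne_zero B (μ := (volume : Measure ℂ))
    have h2 : volume (ZSpan.fundamentalDomain B) ≠ ⊤ :=
      (ZSpan.fundamentalDomain_isBounded B).measure_lt_top.ne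
    exact (ENNReal.toReal_pos h1 h2).ne'
  -- the step function sending `u` to the point of `x⁻¹ (L + w₀)` in the cell of `u`
  let s : ℝ → ℂ → ℂ := fun x u => (x : ℂ)⁻¹ * (ZSpan.floor B ((x : ℂ) * u) + w₀)
  set D : ℝ := ∑ i, ‖B i‖ + ‖w₀‖ with hD
  have hsm : ∀ x, Measurable (s x) := fun x =>
    (((measurable_coe_floor B).comp (measurable_const_mul _)).add_const _).const_mul _
  have hs : ∀ x : ℝ, 0 < x → ∀ u, ‖s x u - u‖ ≤ D / x := by
    intro x hx u
    have hx' : (x : ℂ) ≠ 0 := by exact_mod_cast hx.ne'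
    have h1 : s x u - u = (x : ℂ)⁻¹ * (w₀ - ZSpan.fract B ((x : ℂ) * u)) := by
      simp only [s, ZSpan.fract_apply]; field_simp; ring
    rw [h1, norm_mul, norm_inv, Complex.norm_real, Real.norm_of_nonneg hx.le, inv_mul_eq_div]
    gcongr
    calc _ ≤ ‖w₀‖ + ‖ZSpan.fract B ((x : ℂ) * u)‖ := norm_sub_le _ _
      _ ≤ D := by have := ZSpan.norm_fract_le B ((x : ℂ) * u); linarith
  have hst : ∀ u, Tendsto (fun x => s x u) atTop (𝓝 u) := by
    intro u
    rw [tendsto_iff_norm_sub_tendsto_zero]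
    refine squeeze_zero' (Eventually.of_forall fun _ => norm_nonneg _) ?_
      (tendsto_const_nhds.div_atTop tendsto_id : Tendsto (fun x : ℝ => D / x) atTop (𝓝 0))
    filter_upwards [eventually_gt_atTop 0] with x hx using hs x hx u
  let bound : ℂ → ℝ := (Metric.closedBall (0 : ℂ) (R + D)).indicator fun _ => M
  have hbi : Integrable bound := by
    refine (integrable_indicator_iff Metric.isClosed_closedBall.measurableSet).2 ?_
    exact integrableOn_const (isCompact_closedBall _ _).measure_lt_top.ne
  have hbound : ∀ᶠ x in atTop, ∀ u, ‖h x (s x u)‖ ≤ bound u := by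
    filter_upwards [hR, hM, eventually_ge_atTop 1] with x h1 h2 h3 u
    have hx : 0 < x := by linarith
    by_cases hu : u ∈ Metric.closedBall (0 : ℂ) (R + D)
    · simp only [bound, Set.indicator_of_mem hu]; exact h2 _
    · simp only [bound, Set.indicator_of_notMem hu]
      rw [h1, norm_zero]
      rw [mem_closedBall_zero_iff, not_le] at hu
      have h4 := hs x hx u
      have h5 : D / x ≤ D := div_le_self (by positivity) h3
      have h6 : ‖u‖ ≤ ‖s x u‖ + ‖s x u - u‖ := by
        have := norm_sub_le (s x u) (s x u - u)
        simpa using this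
      linarith
  have hdct : Tendsto (fun x => ∫ u, h x (s x u)) atTop (𝓝 (∫ u, h₀ u)) := by
    refine tendsto_integral_filter_of_dominated_convergence bound
      (Eventually.of_forall fun x => ((hm x).comp (hsm x)).aestronglyMeasurable)
      (hbound.mono fun x hx => Eventually.of_forall hx) hbi ?_
    filter_upwards [hlim] with u hu using hu _ (hst u)
  refine (hdct.div_const V).congr' ?_
  filter_upwards [hbound, eventually_gt_atTop 0] with x hb hx
  have hint : Integrable fun u => h x (s x u) :=
    hbi.mono' ((hm x).comp (hsm x)).aestronglyMeasurable (Eventually.of_forall hb)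
  let g : ℂ → ℝ := fun b => h x ((x : ℂ)⁻¹ * (b + w₀))
  have he : (fun u => h x (s x u)) = fun u : ℂ => (fun v => g (ZSpan.floor B v)) (x • u) := by
    funext u; simp only [s, g, Complex.real_smul]
  rw [he] at hint ⊢
  have hint' : Integrable fun v => g (ZSpan.floor B v) :=
    (integrable_comp_smul_iff volume _ hx.ne').1 hint
  rw [Measure.integral_comp_smul volume (fun v => g (ZSpan.floor B v)),
    integral_comp_floor B g hint', Complex.finrank_real_complex, abs_of_pos (by positivity), smul_eq_mul]
  change _ = (∑' b : span ℤ (Set.range B), g b) / x ^ 2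
  rw [← hV]
  field_simp

/-! ### The ring of integers of an imaginary quadratic field as a lattice -/

section Embedding

variable {K : Type*} [Field K] [NumberField K] [Algebra.IsQuadraticExtension ℚ K]
  [NumberField.IsTotallyComplex K] (σ : K →+* ℂ)

open NumberField ComplexEmbedding in
/-- The embeddings of an imaginary quadratic field in `ℂ` are `σ` and its conjugate, and these are
distinct. -/
theorem univ_algHom_eq [DecidableEq (K →ₐ[ℚ] ℂ)] : (Finset.univ : Finset (K →ₐ[ℚ] ℂ)) =
    {σ.toRatAlgHom, (conjugate σ).toRatAlgHom} ∧
      σ.toRatAlgHom ≠ (conjugate σ).toRatAlgHom := by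
  have hne : σ.toRatAlgHom ≠ (conjugate σ).toRatAlgHom := by
    intro h
    refine IsTotallyComplex.complexEmbedding_not_isReal σ ?_
    rw [isReal_iff]
    ext x
    exact (DFunLike.congr_fun h x).symm
  refine ⟨(Finset.eq_univ_of_card _ ?_).symm, hne⟩
  rw [Finset.card_pair hne, AlgHom.card, Algebra.IsQuadraticExtension.finrank_eq_two]

theorem trace_eq_two_mul_re (x : K) : ((Algebra.trace ℚ K x : ℚ) : ℝ) = 2 * (σ x).re := by
  classical
  have h := trace_eq_sum_embeddings (K := ℚ) (L := K) ℂ (x := x)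
  rw [(univ_algHom_eq σ).1, Finset.sum_pair (univ_algHom_eq σ).2] at h
  have h2 : ((Algebra.trace ℚ K x : ℚ) : ℂ) = σ x + starRingEnd ℂ (σ x) := h
  have h3 := congrArg Complex.re h2
  simp only [Complex.ratCast_re, Complex.add_re, Complex.conj_re] at h3
  linarith

theorem norm_eq_norm_sq (x : K) : ((Algebra.norm ℚ x : ℚ) : ℝ) = ‖σ x‖ ^ 2 := by
  classical
  have h := Algebra.norm_eq_prod_embeddings (K := ℚ) (L := K) (E := ℂ) x
  rw [(univ_algHom_eq σ).1, Finset.prod_pair (univ_algHom_eq σ).2] at h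
  have h2 : ((Algebra.norm ℚ x : ℚ) : ℂ) = σ x * starRingEnd ℂ (σ x) := h
  rw [Complex.mul_conj, Complex.normSq_eq_norm_sq] at h2
  exact_mod_cast h2

theorem absNorm_span_singleton_eq (a : 𝓞 K) :
    (Ideal.absNorm (Ideal.span {a}) : ℝ) = ‖σ a‖ ^ 2 := by
  rw [Ideal.absNorm_span_singleton, ← norm_eq_norm_sq, ← Algebra.coe_norm_int]
  have h : (0 : ℝ) ≤ ((Algebra.norm ℤ a : ℤ) : ℝ) := by
    have := norm_eq_norm_sq σ (a : K)
    rw [← Algebra.coe_norm_int] at this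
    have h2 : ((Algebra.norm ℤ a : ℤ) : ℝ) = ‖σ a‖ ^ 2 := by exact_mod_cast this
    rw [h2]; positivity
  have h' : 0 ≤ Algebra.norm ℤ a := by exact_mod_cast h
  rw [Nat.cast_natAbs, abs_of_nonneg h']
  simp

/-- The discriminant is `-4` times the squared determinant of the real coordinates of an integral
basis: the trace form has entries `2 Re (σ bᵢ σ bⱼ)`. -/
theorem discr_eq_neg_four_mul (b : Basis (Fin 2) ℤ (𝓞 K)) :
    (NumberField.discr K : ℝ) =
      -4 * ((σ (b 0)).re * (σ (b 1)).im - (σ (b 1)).re * (σ (b 0)).im) ^ 2 := by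
  have h0 : NumberField.discr K = Algebra.discr ℤ b := (NumberField.discr_eq_discr K b).symm
  have key : ∀ i j, ((Algebra.trace ℤ (𝓞 K) (b i * b j) : ℤ) : ℝ) =
      2 * (σ (b i) * σ (b j)).re := by
    intro i j
    have := trace_eq_two_mul_re σ ((b i * b j : 𝓞 K) : K)
    rw [← Algebra.coe_trace_int] at this
    simpa using this
  rw [h0, Algebra.discr_def, Matrix.det_fin_two]
  simp only [Algebra.traceMatrix_apply, Algebra.traceForm_apply]
  push_cast
  simp only [key, Complex.mul_re]
  ring

/-- The image of `𝓞 K` in `ℂ` is a lattice of covolume `√|D_K| / 2`. -/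
theorem exists_basis_of_ringOfIntegers : ∃ B : Basis (Fin 2) ℝ ℂ,
    (∀ w, w ∈ span ℤ (Set.range B) ↔ ∃ a : 𝓞 K, σ a = w) ∧
    volume.real (ZSpan.fundamentalDomain B) = √|(NumberField.discr K : ℝ)| / 2 := by
  have hf : finrank ℤ (𝓞 K) = 2 := by
    rw [NumberField.RingOfIntegers.rank, Algebra.IsQuadraticExtension.finrank_eq_two]
  let b : Basis (Fin 2) ℤ (𝓞 K) := finBasisOfFinrankEq ℤ (𝓞 K) hf
  set d : ℝ := (σ (b 0)).re * (σ (b 1)).im - (σ (b 1)).re * (σ (b 0)).im with hd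
  have hD : (NumberField.discr K : ℝ) = -4 * d ^ 2 := discr_eq_neg_four_mul σ b
  have hd0 : d ≠ 0 := by
    intro h
    rw [h] at hD
    have : (NumberField.discr K : ℝ) ≠ 0 := by exact_mod_cast NumberField.discr_ne_zero K
    apply this; rw [hD]; ring
  have hli : LinearIndependent ℝ fun i : Fin 2 => σ (b i) := by
    rw [Fintype.linearIndependent_iff]
    intro g hg
    have hre := congrArg Complex.re hg
    have him := congrArg Complex.im hg
    simp only [Fin.sum_univ_two, Complex.add_re, Complex.add_im, Complex.smul_re, Complex.smul_im,
      Complex.zero_re, Complex.zero_im, smul_eq_mul] at hre him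
    have e0 : g 0 * d = 0 := by rw [hd]; linear_combination (σ (b 1)).im * hre - (σ (b 1)).re * him
    have e1 : g 1 * d = 0 := by rw [hd]; linear_combination (σ (b 0)).re * him - (σ (b 0)).im * hre
    intro i
    fin_cases i
    · exact (mul_eq_zero.1 e0).resolve_right hd0
    · exact (mul_eq_zero.1 e1).resolve_right hd0
  let B : Basis (Fin 2) ℝ ℂ := basisOfLinearIndependentOfCardEqFinrank hli
    (by simp [Complex.finrank_real_complex])
  have hB : ∀ i, B i = σ (b i) := fun i => by simp [B]
  refine ⟨B, fun w => ?_, ?_⟩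
  · let τ : 𝓞 K →ₗ[ℤ] ℂ := (σ.comp (algebraMap (𝓞 K) K)).toAddMonoidHom.toIntLinearMap
    have h1 : span ℤ (Set.range B) = LinearMap.range τ := by
      have : (B : Fin 2 → ℂ) = τ ∘ b := funext hB
      rw [this, Set.range_comp, ← Submodule.map_span, b.span_eq, Submodule.map_top]
    rw [h1, LinearMap.mem_range]
    rfl
  · rw [ZSpan.measureReal_fundamentalDomain B volume Complex.basisOneI]
    have h1 : volume.real (ZSpan.fundamentalDomain Complex.basisOneI) = 1 := by
      have e := measure_congr (ZSpan.fundamentalDomain_ae_parallelepiped Complex.basisOneI volume)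
      have h2 := Complex.orthonormalBasisOneI.volume_parallelepiped
      have h3 : (Complex.basisOneI : Fin 2 → ℂ) = Complex.orthonormalBasisOneI := by
        rw [← Complex.toBasis_orthonormalBasisOneI, OrthonormalBasis.coe_toBasis]
      rw [measureReal_def, e, h3, h2, ENNReal.toReal_one]
    rw [h1, mul_one, Basis.det_apply, Matrix.det_fin_two]
    simp only [Basis.toMatrix_apply, hB, Complex.coe_basisOneI_repr]
    have h3 : √|(NumberField.discr K : ℝ)| = 2 * |d| := by
      rw [hD, abs_mul, abs_of_nonneg (sq_nonneg d), show |(-4 : ℝ)| * d ^ 2 = (2 * |d|) ^ 2 by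
        rw [mul_pow, sq_abs]; norm_num]
      exact Real.sqrt_sq (by positivity)
    rw [h3, hd]
    simp

end Embedding

/-! ### Geometry of angular sectors -/

/-- Multiplication by `m` is a rotation followed by a homothety of ratio `‖m‖`. -/
theorem integral_comp_mul_left_complex (f : ℂ → ℝ) {m : ℂ} (hm : m ≠ 0) :
    ∫ w, f (m * w) = (‖m‖ ^ 2)⁻¹ * ∫ w, f w := by
  have hn : (‖m‖ : ℝ) ≠ 0 := norm_ne_zero_iff.2 hm
  have hn' : (‖m‖ : ℂ) ≠ 0 := by exact_mod_cast hn
  let u : Circle := ⟨m / ‖m‖, by simp [Submonoid.unitSphere, hn]⟩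
  have h1 : ∀ w, m * w = rotation u (‖m‖ • w) := by
    intro w
    rw [rotation_apply, Complex.real_smul]
    change m * w = m / ‖m‖ * (‖m‖ * w)
    field_simp
  simp_rw [h1]
  rw [Measure.integral_comp_smul volume (fun w => f (rotation u w)),
    (rotation u).measurePreserving.integral_comp (rotation u).toMeasurableEquiv.measurableEmbedding]
  rw [Complex.finrank_real_complex, abs_of_pos (by positivity), smul_eq_mul]

/-- The truncated angular sector `sector 1 θ 1`, described by the argument and the modulus. -/
def unitSector (θ : ℝ) : Set ℂ :=
  {w | w ≠ 0 ∧ ‖w‖ ≤ 1 ∧ -(θ / 2) < w.arg ∧ w.arg ≤ θ / 2}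

theorem measurableSet_unitSector (θ : ℝ) : MeasurableSet (unitSector θ) := by
  unfold unitSector
  have ha : Measurable Complex.arg := Complex.measurable_arg
  refine MeasurableSet.inter (measurableSet_singleton 0).compl ?_
  refine MeasurableSet.inter (measurableSet_le measurable_norm measurable_const) ?_
  exact MeasurableSet.inter (measurableSet_lt measurable_const ha)
    (measurableSet_le ha measurable_const)

/-- Rotating by the direction of `z` and rescaling by `1 / x` reduces every sector to
`unitSector θ`. -/
theorem mem_sector_iff {z w : ℂ} {θ x : ℝ} (hz : z ≠ 0) (hθ : θ ≤ 2 * Real.pi) (hx : 0 < x) :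
    w ∈ sector z θ x ↔ (x : ℂ)⁻¹ * (((z / ‖z‖)⁻¹) * w) ∈ unitSector θ := by
  have hn : 0 < ‖z‖ := norm_pos_iff.2 hz
  have hn' : (‖z‖ : ℂ) ≠ 0 := by exact_mod_cast hn.ne'
  have hx' : (x : ℂ) ≠ 0 := by exact_mod_cast hx.ne'
  constructor
  · rintro ⟨t, ρ, ht, ht', hρ, hρ', rfl⟩
    have e : (x : ℂ)⁻¹ * (((z / ‖z‖)⁻¹) * ((ρ : ℂ) * Complex.exp (t * Complex.I) * z)) =
        ((ρ * ‖z‖ / x : ℝ) : ℂ) * Complex.exp (t * Complex.I) := by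
      push_cast; field_simp
    have hp : 0 < ρ * ‖z‖ / x := by positivity
    have ha : (((ρ * ‖z‖ / x : ℝ) : ℂ) * Complex.exp (t * Complex.I)).arg = t := by
      rw [Complex.exp_mul_I]
      exact Complex.arg_mul_cos_add_sin_mul_I hp ⟨by linarith, by linarith⟩
    rw [e]
    refine ⟨?_, ?_, ?_, ?_⟩
    · exact mul_ne_zero (by exact_mod_cast hp.ne') (Complex.exp_ne_zero _)
    · rw [norm_mul, Complex.norm_exp_ofReal_mul_I, mul_one, Complex.norm_real,
        Real.norm_of_nonneg hp.le, div_le_one hx]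
      rwa [le_div_iff₀ hn] at hρ'
    · rwa [ha]
    · rwa [ha]
  · rintro ⟨h0, h1, h2, h3⟩
    set v := (x : ℂ)⁻¹ * (((z / ‖z‖)⁻¹) * w) with hv
    refine ⟨v.arg, ‖v‖ * x / ‖z‖, h2, h3, ?_, ?_, ?_⟩
    · have := norm_pos_iff.2 h0; positivity
    · gcongr
      nlinarith
    · have h4 : w = v * (x * z / ‖z‖) := by rw [hv]; field_simp
      have h5 := Complex.norm_mul_exp_arg_mul_I v
      calc w = v * (x * z / ‖z‖) := h4
        _ = (‖v‖ * Complex.exp (v.arg * Complex.I)) * (x * z / ‖z‖) := by rw [h5]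
        _ = _ := by push_cast; ring

theorem integral_unitSector {θ : ℝ} (hθ : 0 < θ) (hθ' : θ ≤ 2 * Real.pi) :
    ∫ w, (unitSector θ).indicator (fun w => ‖w‖ ^ 4) w = θ / 6 := by
  rw [← Complex.integral_comp_polarCoord_symm]
  have h1 : ∀ p ∈ polarCoord.target, p.1 • (unitSector θ).indicator (fun w => ‖w‖ ^ 4)
      (Complex.polarCoord.symm p) =
      (Set.Ioc (0 : ℝ) 1 ×ˢ Set.Ioc (-(θ / 2)) (θ / 2)).indicator (fun p => p.1 ^ 5 * 1) p := by
    rintro ⟨r, φ⟩ ⟨hr, hφ⟩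
    simp only [Set.mem_Ioi, Set.mem_Ioo] at hr hφ
    have ha : (Complex.polarCoord.symm (r, φ)).arg = φ := by
      rw [Complex.polarCoord_symm_apply]
      push_cast
      exact Complex.arg_mul_cos_add_sin_mul_I hr ⟨hφ.1, hφ.2.le⟩
    have hn : ‖Complex.polarCoord.symm (r, φ)‖ = r := by
      rw [Complex.norm_polarCoord_symm, abs_of_pos hr]
    have h0 : Complex.polarCoord.symm (r, φ) ≠ 0 := by
      rw [← norm_pos_iff, hn]; exact hr
    by_cases h : (r, φ) ∈ Set.Ioc (0 : ℝ) 1 ×ˢ Set.Ioc (-(θ / 2)) (θ / 2)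
    · rw [Set.indicator_of_mem h, Set.indicator_of_mem]
      · rw [hn, smul_eq_mul]; ring
      · exact ⟨h0, by rw [hn]; exact h.1.2, by rw [ha]; exact h.2.1, by rw [ha]; exact h.2.2⟩
    · rw [Set.indicator_of_notMem h, Set.indicator_of_notMem, smul_zero]
      rintro ⟨_, h2, h3, h4⟩
      rw [ha] at h3 h4
      rw [hn] at h2
      exact h ⟨⟨hr, h2⟩, h3, h4⟩
  have hms : MeasurableSet (Set.Ioc (0 : ℝ) 1 ×ˢ Set.Ioc (-(θ / 2)) (θ / 2)) :=
    measurableSet_Ioc.prod measurableSet_Ioc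
  rw [setIntegral_congr_fun polarCoord.open_target.measurableSet h1, setIntegral_indicator hms]
  have hae : (polarCoord.target ∩ Set.Ioc (0 : ℝ) 1 ×ˢ Set.Ioc (-(θ / 2)) (θ / 2) : Set (ℝ × ℝ))
      =ᵐ[volume] (Set.Ioc (0 : ℝ) 1 ×ˢ Set.Ioc (-(θ / 2)) (θ / 2) : Set (ℝ × ℝ)) := by
    have e : (polarCoord.target ∩ Set.Ioc (0 : ℝ) 1 ×ˢ Set.Ioc (-(θ / 2)) (θ / 2) : Set (ℝ × ℝ)) =
        (Set.Ioc (0 : ℝ) 1 ×ˢ (Set.Ioo (-Real.pi) Real.pi ∩ Set.Ioc (-(θ / 2)) (θ / 2))) := by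
      ext ⟨r, φ⟩
      simp only [polarCoord_target, Set.mem_inter_iff, Set.mem_prod, Set.mem_Ioi, Set.mem_Ioc]
      tauto
    rw [e, Measure.volume_eq_prod]
    refine Measure.set_prod_ae_eq (ae_eq_refl _) ?_
    have e2 : (Set.Ioc (-(θ / 2)) (θ / 2) : Set ℝ) =
        Set.Ioc (-Real.pi) Real.pi ∩ Set.Ioc (-(θ / 2)) (θ / 2) := by
      rw [eq_comm, Set.inter_eq_right]
      exact Set.Ioc_subset_Ioc (by linarith) (by linarith)
    conv_rhs => rw [e2]
    exact Ioo_ae_eq_Ioc.inter (ae_eq_refl _)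
  rw [setIntegral_congr_set hae, Measure.volume_eq_prod,
    setIntegral_prod_mul (fun r : ℝ => r ^ 5) (fun _ : ℝ => (1 : ℝ))]
  rw [← intervalIntegral.integral_of_le zero_le_one, integral_pow]
  simp only [setIntegral_const, smul_eq_mul, mul_one, measureReal_def, Real.volume_Ioc]
  rw [ENNReal.toReal_ofReal (by linarith)]
  norm_num
  ring

theorem volume_span_singleton (v : ℂ) : volume ((span ℝ {v} : Submodule ℝ ℂ) : Set ℂ) = 0 := by
  refine Measure.addHaar_submodule _ _ fun h => ?_
  have h1 := finrank_span_le_card (R := ℝ) ({v} : Set ℂ)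
  rw [h, finrank_top, Complex.finrank_real_complex, Set.toFinset_singleton,
    Finset.card_singleton] at h1
  omega

theorem ae_arg_ne (c : ℝ) : ∀ᵐ u : ℂ, u.arg ≠ c := by
  refine measure_mono_null (fun u hu => ?_) (volume_span_singleton (Complex.exp (c * Complex.I)))
  have hu' : u.arg = c := by simpa using hu
  have h := Complex.norm_mul_exp_arg_mul_I u
  rw [hu'] at h
  rw [← h]
  refine Submodule.mem_span_singleton.2 ⟨‖u‖, by simp⟩

/-- The indicator function of `unitSector θ` is locally constant almost everywhere: the boundary lies
in the unit circle, three rays and the origin. -/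
theorem ae_eventually_mem_unitSector (θ : ℝ) :
    ∀ᵐ u : ℂ, ∀ᶠ w in 𝓝 u, (w ∈ unitSector θ ↔ u ∈ unitSector θ) := by
  have hsph : ∀ᵐ u : ℂ, ‖u‖ ≠ 1 := by
    have := Measure.addHaar_sphere (volume : Measure ℂ) 0 1
    refine measure_mono_null (fun u hu => ?_) this
    simpa using hu
  have h0 : ∀ᵐ u : ℂ, u ≠ 0 := by
    refine measure_mono_null (t := {0}) (fun u hu => ?_) (by simp)
    simpa using hu
  filter_upwards [ae_arg_ne Real.pi, ae_arg_ne (θ / 2), ae_arg_ne (-(θ / 2)), hsph, h0]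
    with u h1 h2 h3 h4 h5
  have hs : u ∈ Complex.slitPlane := Complex.mem_slitPlane_iff_arg.2 ⟨h1, h5⟩
  have hc : ContinuousAt Complex.arg u := Complex.continuousAt_arg hs
  have e0 : ∀ᶠ w in 𝓝 u, w ≠ 0 := eventually_ne_nhds h5
  have e1 : ∀ᶠ w in 𝓝 u, (‖w‖ ≤ 1 ↔ ‖u‖ ≤ 1) := by
    rcases lt_or_gt_of_ne h4 with h | h
    · filter_upwards [continuous_norm.continuousAt.eventually_lt_const h] with w hw
      exact iff_of_true hw.le h.le
    · filter_upwards [continuous_norm.continuousAt.eventually_const_lt h] with w hw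
      exact iff_of_false (not_le.2 hw) (not_le.2 h)
  have e2 : ∀ᶠ w in 𝓝 u, (w.arg ≤ θ / 2 ↔ u.arg ≤ θ / 2) := by
    rcases lt_or_gt_of_ne h2 with h | h
    · filter_upwards [hc.eventually_lt_const h] with w hw
      exact iff_of_true hw.le h.le
    · filter_upwards [hc.eventually_const_lt h] with w hw
      exact iff_of_false (not_le.2 hw) (not_le.2 h)
  have e3 : ∀ᶠ w in 𝓝 u, (-(θ / 2) < w.arg ↔ -(θ / 2) < u.arg) := by
    rcases lt_or_gt_of_ne h3 with h | h
    · filter_upwards [hc.eventually_lt_const h] with w hw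
      exact iff_of_false (not_lt.2 hw.le) (not_lt.2 h.le)
    · filter_upwards [hc.eventually_const_lt h] with w hw
      exact iff_of_true hw h
  filter_upwards [e0, e1, e2, e3] with w w0 w1 w2 w3
  simp only [unitSector, Set.mem_ofPred_eq]
  rw [w1, w2, w3]
  simp [w0, h5]

/-! ### Lattice sums over residue classes and counting of integers -/

theorem map_coe_injective {K : Type*} [Field K] (σ : K →+* ℂ) :
    Function.Injective fun a : 𝓞 K => σ a :=
  σ.injective.comp NumberField.RingOfIntegers.coe_injective

section Lattice

variable {K : Type*} [Field K] [NumberField K] [Algebra.IsQuadraticExtension ℚ K]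
  [NumberField.IsTotallyComplex K] (σ : K →+* ℂ)

/-- Riemann sums over the points `w₀ + m σ(b)`, `b ∈ 𝓞 K`. -/
theorem tendsto_tsum_coset_div_sq {m : ℂ} (hm0 : m ≠ 0) (w₀ : ℂ) (h : ℝ → ℂ → ℝ)
    (h₀ : ℂ → ℝ) (hm : ∀ x, Measurable (h x)) (M R : ℝ)
    (hR : ∀ᶠ x in atTop, ∀ w, R < ‖w‖ → h x w = 0)
    (hM : ∀ᶠ x in atTop, ∀ w, |h x w| ≤ M)
    (hlim : ∀ᵐ u, ∀ v : ℝ → ℂ, Tendsto v atTop (𝓝 u) →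
      Tendsto (fun x => h x (v x)) atTop (𝓝 (h₀ u))) :
    Tendsto (fun x : ℝ => (∑' b : 𝓞 K, h x ((x : ℂ)⁻¹ * (w₀ + m * σ b))) / x ^ 2)
      atTop (𝓝 ((∫ u, h₀ u) * (2 / (√|(NumberField.discr K : ℝ)| * ‖m‖ ^ 2)))) := by
  obtain ⟨B, hB, hV⟩ := exists_basis_of_ringOfIntegers σ
  have hn : 0 < ‖m‖ := norm_pos_iff.2 hm0
  let e : 𝓞 K ≃ span ℤ (Set.range B) :=
    Equiv.ofBijective (fun a => ⟨σ a, (hB _).2 ⟨a, rfl⟩⟩)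
      ⟨fun a b hab => map_coe_injective σ (congrArg Subtype.val hab),
        fun w => by
          obtain ⟨a, ha⟩ := (hB _).1 w.2
          exact ⟨a, Subtype.ext ha⟩⟩
  have key := tendsto_tsum_lattice_div_sq B (m⁻¹ * w₀) (fun x w => h x (m * w))
    (fun w => h₀ (m * w)) (fun x => (hm x).comp (measurable_const_mul m)) M (R / ‖m‖)
    (hR.mono fun x hx w hw => hx _ (by
      rw [norm_mul]; rw [div_lt_iff₀ hn] at hw; linarith))
    (hM.mono fun x hx w => hx _) ?_
  · rw [integral_comp_mul_left_complex h₀ hm0, hV] at key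
    refine (key.congr fun x => ?_).trans_eq ?_
    · congr 1
      rw [← e.tsum_eq]
      refine tsum_congr fun b => congrArg _ ?_
      change m * ((x : ℂ)⁻¹ * (σ b + m⁻¹ * w₀)) = _
      field_simp
      ring
    · congr 1
      field_simp
  · have hq : Measure.QuasiMeasurePreserving (fun w : ℂ => m * w) volume volume := by
      refine ⟨measurable_const_mul m, Measure.AbsolutelyContinuous.mk fun s hs h0 => ?_⟩
      rw [Measure.map_apply (measurable_const_mul m) hs]
      have hl : (fun w : ℂ => m * w) ⁻¹' s =
          (LinearEquiv.smulOfNeZero ℂ ℂ m hm0).restrictScalars ℝ ⁻¹' s := rfl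
      rw [hl, Measure.addHaar_preimage_linearEquiv, h0, mul_zero]
    filter_upwards [hq.ae hlim] with u hu v hv
    exact hu _ (hv.const_mul m)

theorem one_le_norm_map {a : 𝓞 K} (ha : a ≠ 0) : 1 ≤ ‖σ a‖ := by
  have h := absNorm_span_singleton_eq σ a
  have h1 : 1 ≤ Ideal.absNorm (Ideal.span {a}) := by
    rw [Nat.one_le_iff_ne_zero, Ne, Ideal.absNorm_eq_zero_iff, Ideal.span_singleton_eq_bot]
    exact ha
  have h2 : (1 : ℝ) ≤ ‖σ a‖ ^ 2 := by rw [← h]; exact_mod_cast h1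
  nlinarith [norm_nonneg (σ a)]

theorem finite_setOf_norm_map_le (X : ℝ) : {a : 𝓞 K | ‖σ a‖ ≤ X}.Finite := by
  obtain ⟨B, hB, -⟩ := exists_basis_of_ringOfIntegers σ
  have h := ZSpan.setFinite_inter B (Metric.isBounded_closedBall (x := (0 : ℂ)) (r := X))
  refine Set.Finite.of_finite_image (f := fun a : 𝓞 K => σ a) (h.subset ?_)
    (map_coe_injective σ).injOn
  rintro _ ⟨a, ha, rfl⟩
  exact ⟨by simpa using ha, (hB _).2 ⟨a, rfl⟩⟩

theorem summable_inv_norm_map_pow_four : Summable fun a : 𝓞 K => (‖σ a‖ ^ 4)⁻¹ := by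
  obtain ⟨B, hB, -⟩ := exists_basis_of_ringOfIntegers σ
  have hf : finrank ℤ (span ℤ (Set.range B)) = 2 := by
    rw [ZLattice.rank ℝ, Complex.finrank_real_complex]
  have h := ZLattice.summable_norm_pow_inv (span ℤ (Set.range B)) 4 (by rw [hf]; norm_num)
  let e : 𝓞 K → span ℤ (Set.range B) := fun a => ⟨σ a, (hB _).2 ⟨a, rfl⟩⟩
  have he : Function.Injective e := fun a b hab =>
    map_coe_injective σ (congrArg Subtype.val hab)
  refine (h.comp_injective he).congr fun a => ?_
  simp [e]

/-- There are `O(X ^ 2)` nonzero integers of modulus at most `X`. Excluding `0` makes the bound valid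
for all `X ≥ 0`, since nonzero integers have modulus at least `1`. -/
theorem exists_ncard_norm_map_le : ∃ C : ℝ, 0 < C ∧ ∀ X : ℝ, 0 ≤ X →
    ({a : 𝓞 K | a ≠ 0 ∧ ‖σ a‖ ≤ X}.ncard : ℝ) ≤ C * X ^ 2 := by
  have hfin : ∀ X : ℝ, {a : 𝓞 K | a ≠ 0 ∧ ‖σ a‖ ≤ X}.Finite := fun X =>
    (finite_setOf_norm_map_le σ X).subset fun a ha => ha.2
  -- integers of modulus at most `X` are counted by a Riemann sum for the closed unit disc
  let S : Set ℂ := Metric.closedBall 0 1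
  have hS : MeasurableSet S := Metric.isClosed_closedBall.measurableSet
  have key := tendsto_tsum_coset_div_sq σ one_ne_zero 0 (fun _ => S.indicator fun _ => 1)
    (S.indicator fun _ => 1) (fun _ => measurable_const.indicator hS) 1 1
    (Eventually.of_forall fun x w hw => Set.indicator_of_notMem (by simpa [S] using hw) _)
    (Eventually.of_forall fun x w => by
      by_cases hw : w ∈ S <;> simp [hw]) (by
      have hsph : ∀ᵐ u : ℂ, ‖u‖ ≠ 1 := by
        have := Measure.addHaar_sphere (volume : Measure ℂ) 0 1
        refine measure_mono_null (fun u hu => ?_) this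
        simpa using hu
      filter_upwards [hsph] with u hu v hv
      refine tendsto_const_nhds.congr' ?_
      have hn := hv.norm
      rcases lt_or_gt_of_ne hu with h | h
      · filter_upwards [hn.eventually_lt_const h] with x hx
        rw [Set.indicator_of_mem, Set.indicator_of_mem] <;> simp [S, hx.le, h.le]
      · filter_upwards [hn.eventually_const_lt h] with x hx
        rw [Set.indicator_of_notMem, Set.indicator_of_notMem] <;> simp [S, hx, h])
  set c := (∫ u, S.indicator (fun _ => (1 : ℝ)) u) *
    (2 / (√|(NumberField.discr K : ℝ)| * ‖(1 : ℂ)‖ ^ 2))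
  have hcount : ∀ X : ℝ, 0 < X → ({a : 𝓞 K | a ≠ 0 ∧ ‖σ a‖ ≤ X}.ncard : ℝ) ≤
      ∑' b : 𝓞 K, S.indicator (fun _ => (1 : ℝ)) ((X : ℂ)⁻¹ * (0 + 1 * σ b)) := by
    intro X hX
    have hmem : ∀ b : 𝓞 K, (X : ℂ)⁻¹ * (0 + 1 * σ b) ∈ S ↔ ‖σ b‖ ≤ X := by
      intro b
      simp only [S, mem_closedBall_zero_iff, zero_add, one_mul, norm_mul, norm_inv,
        Complex.norm_real, Real.norm_of_nonneg hX.le]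
      rw [inv_mul_le_iff₀ hX, mul_one]
    rw [tsum_eq_sum (s := (finite_setOf_norm_map_le σ X).toFinset) fun b hb =>
      Set.indicator_of_notMem (by rw [hmem]; simpa using hb) _]
    rw [Set.ncard_eq_toFinset_card _ (hfin X), Finset.card_eq_sum_ones, Nat.cast_sum]
    refine (Finset.sum_le_sum_of_subset_of_nonneg (t := (finite_setOf_norm_map_le σ X).toFinset)
      (fun a ha => ?_) fun _ _ _ => by positivity).trans (Finset.sum_le_sum fun b hb => ?_)
    · simp only [Set.Finite.mem_toFinset, Set.mem_ofPred_eq] at ha ⊢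
      exact ha.2
    · rw [Set.indicator_of_mem ((hmem b).2 (by simpa using hb))]
      simp
  obtain ⟨x₀, hx₀, hlarge⟩ : ∃ x₀ : ℝ, 1 ≤ x₀ ∧ ∀ X ≥ x₀,
      ({a : 𝓞 K | a ≠ 0 ∧ ‖σ a‖ ≤ X}.ncard : ℝ) ≤ (|c| + 1) * X ^ 2 := by
    have h1 := key.eventually_lt_const (show c < |c| + 1 by linarith [le_abs_self c])
    obtain ⟨x₁, hx₁⟩ := eventually_atTop.1 h1
    refine ⟨max x₁ 1, le_max_right _ _, fun X hX => ?_⟩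
    have hX1 : 1 ≤ X := (le_max_right _ _).trans hX
    have h2 := hx₁ X ((le_max_left _ _).trans hX)
    rw [div_lt_iff₀ (by positivity)] at h2
    exact (hcount X (by linarith)).trans h2.le
  refine ⟨(|c| + 1) * x₀ ^ 2, by positivity, fun X hX => ?_⟩
  -- below `1` the count vanishes; above `1`, the bound at `x₀ * X ≥ x₀` is used
  rcases lt_or_ge X 1 with h | h
  · have : {a : 𝓞 K | a ≠ 0 ∧ ‖σ a‖ ≤ X} = ∅ := by
      ext a
      simp only [Set.mem_ofPred_eq, Set.mem_empty_iff_false, iff_false, not_and, not_le]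
      intro ha
      exact h.trans_le (one_le_norm_map σ ha)
    rw [this, Set.ncard_empty, Nat.cast_zero]
    positivity
  · have h1 : ({a : 𝓞 K | a ≠ 0 ∧ ‖σ a‖ ≤ X}.ncard : ℝ) ≤
        ({a : 𝓞 K | a ≠ 0 ∧ ‖σ a‖ ≤ x₀ * X}.ncard : ℝ) := by
      have hsub : {a : 𝓞 K | a ≠ 0 ∧ ‖σ a‖ ≤ X} ⊆ {a : 𝓞 K | a ≠ 0 ∧ ‖σ a‖ ≤ x₀ * X} :=
        fun a ha => ⟨ha.1, ha.2.trans (by nlinarith)⟩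
      exact_mod_cast Set.ncard_le_ncard hsub (hfin _)
    have h2 := hlarge (x₀ * X) (by nlinarith)
    calc _ ≤ _ := h1
      _ ≤ _ := h2
      _ = _ := by ring

open Classical in
/-- The sum of `‖a‖² ‖a + κ‖²` over the points `a = w₀ + m σ(b)` of the sector: the integral of
`‖w‖ ^ 4` over the unit sector is `θ / 6`, and the covolume is `√|D_K| ‖m‖² / 2`. -/
theorem tendsto_sum_sector_coset {z : ℂ} (hz : z ≠ 0) {θ : ℝ} (hθ : 0 < θ)
    (hθ' : θ ≤ 2 * Real.pi) {m : ℂ} (hm0 : m ≠ 0) (w₀ κ : ℂ) :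
    Tendsto (fun x : ℝ => (∑' b : 𝓞 K, if w₀ + m * σ b ∈ sector z θ x then
        ‖w₀ + m * σ b‖ ^ 2 * ‖w₀ + m * σ b + κ‖ ^ 2 else 0) / x ^ 6)
      atTop (𝓝 (θ / (3 * √|(NumberField.discr K : ℝ)|) / ‖m‖ ^ 2)) := by
  have hn : 0 < ‖z‖ := norm_pos_iff.2 hz
  have hn' : (‖z‖ : ℂ) ≠ 0 := by exact_mod_cast hn.ne'
  set u₀ : ℂ := (z / ‖z‖)⁻¹ with hu₀
  have hun : ‖u₀‖ = 1 := by simp [hu₀, hn.ne']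
  have hu0 : u₀ ≠ 0 := by rw [← norm_pos_iff, hun]; exact one_pos
  let S := unitSector θ
  have hS : MeasurableSet S := measurableSet_unitSector θ
  -- the test function after rotation and rescaling; the shift `κ` becomes negligible
  let h : ℝ → ℂ → ℝ := fun x => S.indicator fun w => ‖w‖ ^ 2 * ‖w + u₀ * κ / x‖ ^ 2
  have hlim : ∀ᵐ u, ∀ v : ℝ → ℂ, Tendsto v atTop (𝓝 u) →
      Tendsto (fun x => h x (v x)) atTop (𝓝 (S.indicator (fun w => ‖w‖ ^ 4) u)) := by
    filter_upwards [ae_eventually_mem_unitSector θ] with u hu v hv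
    have hk : Tendsto (fun x : ℝ => u₀ * κ / x) atTop (𝓝 0) := by
      have h1 : Tendsto (fun x : ℝ => u₀ * κ * ((x⁻¹ : ℝ) : ℂ)) atTop (𝓝 (u₀ * κ * ((0 : ℝ) : ℂ))) :=
        ((Complex.continuous_ofReal.tendsto _).comp tendsto_inv_atTop_zero).const_mul _
      rw [Complex.ofReal_zero, mul_zero] at h1
      refine h1.congr fun x => ?_
      push_cast
      rw [div_eq_mul_inv]
    have hw : Tendsto (fun x => ‖v x‖ ^ 2 * ‖v x + u₀ * κ / x‖ ^ 2) atTop (𝓝 (‖u‖ ^ 4)) := by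
      have := (hv.norm.pow 2).mul ((hv.add hk).norm.pow 2)
      rw [add_zero, ← pow_add] at this
      exact this
    by_cases hus : u ∈ S
    · rw [Set.indicator_of_mem hus]
      refine hw.congr' ?_
      filter_upwards [hv.eventually hu] with x hx
      exact (Set.indicator_of_mem (hx.2 hus) (fun w : ℂ => ‖w‖ ^ 2 * ‖w + u₀ * κ / x‖ ^ 2)).symm
    · rw [Set.indicator_of_notMem hus]
      refine tendsto_const_nhds.congr' ?_
      filter_upwards [hv.eventually hu] with x hx
      exact (Set.indicator_of_notMem (fun h => hus (hx.1 h))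
        (fun w : ℂ => ‖w‖ ^ 2 * ‖w + u₀ * κ / x‖ ^ 2)).symm
  have hmeas : ∀ x, Measurable (h x) := fun x =>
    Measurable.indicator (by fun_prop) hS
  have hR : ∀ᶠ x in atTop, ∀ w, 1 < ‖w‖ → h x w = 0 :=
    Eventually.of_forall fun x w hw =>
      Set.indicator_of_notMem (fun h => absurd h.2.1 (not_le.2 hw)) _
  have hM : ∀ᶠ x in atTop, ∀ w, |h x w| ≤ (1 + ‖κ‖) ^ 2 := by
    filter_upwards [eventually_ge_atTop 1] with x hx w
    by_cases hw : w ∈ S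
    · have h1 : ‖w‖ ≤ 1 := hw.2.1
      have h2 : ‖w + u₀ * κ / x‖ ≤ 1 + ‖κ‖ := by
        refine (norm_add_le _ _).trans (add_le_add h1 ?_)
        rw [norm_div, norm_mul, hun, one_mul, Complex.norm_real,
          Real.norm_of_nonneg (by linarith)]
        exact div_le_self (norm_nonneg _) hx
      simp only [h, Set.indicator_of_mem hw]
      rw [abs_of_nonneg (by positivity)]
      calc ‖w‖ ^ 2 * ‖w + u₀ * κ / x‖ ^ 2 ≤ 1 ^ 2 * (1 + ‖κ‖) ^ 2 := by gcongr
        _ = _ := by ring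
    · simp only [h, Set.indicator_of_notMem hw, abs_zero]
      positivity
  have key := tendsto_tsum_coset_div_sq σ (mul_ne_zero hu0 hm0) (u₀ * w₀) h _ hmeas _ _ hR hM hlim
  rw [integral_unitSector hθ hθ', norm_mul, hun, one_mul] at key
  refine (key.congr' ?_).trans_eq ?_
  · filter_upwards [eventually_gt_atTop 0] with x hx
    have hx' : (x : ℂ) ≠ 0 := by exact_mod_cast hx.ne'
    have e1 : ∀ b : 𝓞 K, h x ((x : ℂ)⁻¹ * (u₀ * w₀ + u₀ * m * σ b)) =
        (if w₀ + m * σ b ∈ sector z θ x then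
          ‖w₀ + m * σ b‖ ^ 2 * ‖w₀ + m * σ b + κ‖ ^ 2 else 0) * (x ^ 4)⁻¹ := by
      intro b
      have e2 : (x : ℂ)⁻¹ * (u₀ * w₀ + u₀ * m * σ b) = (x : ℂ)⁻¹ * (u₀ * (w₀ + m * σ b)) := by ring
      rw [e2]
      set a := w₀ + m * σ b
      have e3 := mem_sector_iff (w := a) hz hθ' hx
      by_cases ha : a ∈ sector z θ x
      · rw [if_pos ha]
        have e4 : ‖(x : ℂ)⁻¹ * (u₀ * a)‖ = x⁻¹ * ‖a‖ := by
          rw [norm_mul, norm_mul, hun, one_mul, norm_inv, Complex.norm_real,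
            Real.norm_of_nonneg hx.le]
        have e5 : ‖(x : ℂ)⁻¹ * (u₀ * a) + u₀ * κ / x‖ = x⁻¹ * ‖a + κ‖ := by
          rw [show (x : ℂ)⁻¹ * (u₀ * a) + u₀ * κ / x = (x : ℂ)⁻¹ * (u₀ * (a + κ)) by
            field_simp]
          rw [norm_mul, norm_mul, hun, one_mul, norm_inv, Complex.norm_real,
            Real.norm_of_nonneg hx.le]
        simp only [h]
        rw [Set.indicator_of_mem (e3.1 ha), e4, e5]
        field_simp
      · rw [if_neg ha, zero_mul]
        exact Set.indicator_of_notMem (fun hh => ha (e3.2 hh)) _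
    simp_rw [e1]
    rw [tsum_mul_right]
    field_simp
  · congr 1
    field_simp
    norm_num

end Lattice

/-! ### Euler products for the totient and their mean values -/

theorem one_sub_sum_le_prod_one_sub {ι : Type*} (s : Finset ι) (f : ι → ℝ)
    (h0 : ∀ i ∈ s, 0 ≤ f i) (h1 : ∀ i ∈ s, f i ≤ 1) :
    1 - ∑ i ∈ s, f i ≤ ∏ i ∈ s, (1 - f i) := by
  classical
  induction s using Finset.induction_on with
  | empty => simp
  | insert a s ha ih =>
    rw [Finset.sum_insert ha, Finset.prod_insert ha]
    have ih' := ih (fun i hi => h0 i (Finset.mem_insert_of_mem hi))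
      (fun i hi => h1 i (Finset.mem_insert_of_mem hi))
    have ha0 := h0 a (Finset.mem_insert_self _ _)
    have ha1 := h1 a (Finset.mem_insert_self _ _)
    have hs : 0 ≤ ∑ i ∈ s, f i :=
      Finset.sum_nonneg fun i hi => h0 i (Finset.mem_insert_of_mem hi)
    nlinarith

/-- A surjection of finite groups preserves densities of subsets. -/
theorem card_preimage_mul_card {G H : Type*} [AddCommGroup G] [AddCommGroup H] [Finite G]
    [Finite H] (f : G →+ H) (hf : Function.Surjective f) (T : Set H) :
    Nat.card (f ⁻¹' T) * Nat.card H = Nat.card T * Nat.card G := by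
  classical
  have := Fintype.ofFinite G
  have := Fintype.ofFinite H
  have key : ∀ U : Set H, Nat.card (f ⁻¹' U) = Nat.card U * Nat.card f.ker := by
    intro U
    rw [← Nat.card_prod]
    let g := Function.surjInv hf
    have hg : ∀ h, f (g h) = h := Function.surjInv_eq hf
    refine Nat.card_congr
      { toFun := fun x => (⟨f x, x.2⟩, ⟨x - g (f x), by simp [AddMonoidHom.mem_ker, hg]⟩)
        invFun := fun y => ⟨g y.1 + y.2, by
          have : f y.2 = 0 := y.2.2
          simp [hg, this]⟩
        left_inv := fun x => by simp
        right_inv := fun y => ?_ }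
    have : f y.2 = 0 := y.2.2
    ext <;> simp [hg, this]
  have h1 := key T
  have h2 := key Set.univ
  rw [Set.preimage_univ, Nat.card_congr (Equiv.Set.univ G), Nat.card_congr (Equiv.Set.univ H)] at h2
  rw [h1, h2]
  ring

theorem card_setOf_isUnit (R : Type*) [Monoid R] : Nat.card {y : R | IsUnit y} = Nat.card Rˣ :=
  (Nat.card_congr (Equiv.ofBijective (fun u : Rˣ => (⟨u, u.isUnit⟩ : {y : R | IsUnit y}))
    ⟨fun _ _ h => Units.ext (congrArg Subtype.val h),
      fun y => ⟨y.2.unit, Subtype.ext y.2.unit_spec⟩⟩)).symm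

section Arithmetic

open IsDedekindDomain

variable {K : Type*} [Field K] [NumberField K]

theorem finite_quotient {I : Ideal (𝓞 K)} (hI : I ≠ ⊥) : Finite (𝓞 K ⧸ I) :=
  Ring.HasFiniteQuotients.finiteQuotient hI

theorem card_quotient_eq_absNorm (I : Ideal (𝓞 K)) : Nat.card (𝓞 K ⧸ I) = Ideal.absNorm I := by
  rw [Ideal.absNorm_apply, Submodule.cardQuot_apply]

theorem two_le_absNorm (p : HeightOneSpectrum (𝓞 K)) : 2 ≤ Ideal.absNorm p.asIdeal := by
  have h0 : Ideal.absNorm p.asIdeal ≠ 0 := by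
    rw [Ne, Ideal.absNorm_eq_zero_iff]; exact p.ne_bot
  have h1 : Ideal.absNorm p.asIdeal ≠ 1 := by
    rw [Ne, Ideal.absNorm_eq_one_iff]; exact p.isPrime.ne_top
  omega

theorem two_le_absNorm_real (p : HeightOneSpectrum (𝓞 K)) :
    (2 : ℝ) ≤ (Ideal.absNorm p.asIdeal : ℝ) := by
  exact_mod_cast two_le_absNorm p

/-- The intersection of a finite set of maximal ideals, which is also their product. -/
noncomputable def infPrimes (s : Finset (HeightOneSpectrum (𝓞 K))) : Ideal (𝓞 K) :=
  ⨅ p : s, p.1.asIdeal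

omit [NumberField K] in
theorem mem_infPrimes {s : Finset (HeightOneSpectrum (𝓞 K))} {a : 𝓞 K} :
    a ∈ infPrimes s ↔ ∀ p ∈ s, a ∈ p.asIdeal := by
  simp [infPrimes, Submodule.mem_iInf]

/-- The Chinese remainder isomorphism modulo a finite set of maximal ideals. -/
noncomputable def quotientInfPrimesEquiv (s : Finset (HeightOneSpectrum (𝓞 K))) :
    (𝓞 K ⧸ infPrimes s) ≃+* ∀ p : s, 𝓞 K ⧸ p.1.asIdeal :=
  Ideal.quotientInfRingEquivPiQuotient _ fun p q hpq => by
    have := p.1.isMaximal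
    have := q.1.isMaximal
    refine Ideal.isCoprime_of_isMaximal fun h => hpq ?_
    exact Subtype.ext (HeightOneSpectrum.ext h)

theorem quotientInfPrimesEquiv_mk (s : Finset (HeightOneSpectrum (𝓞 K))) (a : 𝓞 K) (p : s) :
    quotientInfPrimesEquiv s (Ideal.Quotient.mk _ a) p = Ideal.Quotient.mk _ a := rfl

theorem absNorm_infPrimes (s : Finset (HeightOneSpectrum (𝓞 K))) :
    Ideal.absNorm (infPrimes s) = ∏ p ∈ s, Ideal.absNorm p.asIdeal := by
  rw [← card_quotient_eq_absNorm, Nat.card_congr (quotientInfPrimesEquiv s).toEquiv, Nat.card_pi]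
  simp only [card_quotient_eq_absNorm]
  exact Finset.prod_coe_sort s fun p => Ideal.absNorm p.asIdeal

theorem infPrimes_ne_bot (s : Finset (HeightOneSpectrum (𝓞 K))) : infPrimes s ≠ ⊥ := by
  rw [Ne, ← Ideal.absNorm_eq_zero_iff, absNorm_infPrimes, Finset.prod_eq_zero_iff]
  rintro ⟨p, -, hp⟩
  have := two_le_absNorm p
  omega

theorem card_units_quotient_infPrimes (s : Finset (HeightOneSpectrum (𝓞 K))) :
    Nat.card (𝓞 K ⧸ infPrimes s)ˣ = ∏ p ∈ s, (Ideal.absNorm p.asIdeal - 1) := by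
  rw [Nat.card_congr ((Units.mapEquiv (quotientInfPrimesEquiv s).toMulEquiv).trans
    MulEquiv.piUnits).toEquiv, Nat.card_pi, ← Finset.prod_coe_sort s]
  refine Finset.prod_congr rfl fun p _ => ?_
  have := p.1.isMaximal
  let := Ideal.Quotient.field p.1.asIdeal
  rw [Nat.card_units, card_quotient_eq_absNorm]

/-- The finite set of primes dividing a nonzero element (and the empty set for `0`). -/
noncomputable def primeFactors (a : 𝓞 K) : Finset (HeightOneSpectrum (𝓞 K)) :=
  open Classical in
  if h : a = 0 then ∅ else
    (Ideal.finite_factors (I := Ideal.span {a}) (by simpa using h)).toFinset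

theorem mem_primeFactors {a : 𝓞 K} (ha : a ≠ 0) {p : HeightOneSpectrum (𝓞 K)} :
    p ∈ primeFactors a ↔ a ∈ p.asIdeal := by
  simp [primeFactors, ha, Ideal.dvd_span_singleton]

/-- The intersection of the primes dividing `a` is the radical of `(a)`. -/
theorem infPrimes_primeFactors {a : 𝓞 K} (ha : a ≠ 0) :
    infPrimes (primeFactors a) = (Ideal.span {a}).radical := by
  refine le_antisymm ?_ ?_
  · rw [Ideal.radical_eq_sInf]
    refine le_sInf fun P hP => ?_
    obtain ⟨h1, h2⟩ := hP
    have haP : a ∈ P := h1 (Ideal.mem_span_singleton_self a)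
    intro b hb
    have hP0 : P ≠ ⊥ := fun h => ha (by simpa [h] using haP)
    exact mem_infPrimes.1 hb ⟨P, h2, hP0⟩ ((mem_primeFactors ha).2 haP)
  · intro b hb
    rw [mem_infPrimes]
    intro p hp
    have hpp := p.isPrime
    refine (Ideal.IsPrime.radical_le_iff hpp).2 ?_ hb
    rw [Ideal.span_singleton_le_iff_mem]
    exact (mem_primeFactors ha).1 hp

/-- Euler's formula for `φ_K(a)`, with denominators cleared. An element of `𝓞 K ⧸ (a)` is a unit if
and only if its image modulo the radical of `(a)` is one, and modulo the radical the units are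
counted by the Chinese remainder theorem. -/
theorem eulerPhiElem_mul_absNorm {a : 𝓞 K} (ha : a ≠ 0) :
    eulerPhiElem K a * Ideal.absNorm (infPrimes (primeFactors a)) =
      (∏ p ∈ primeFactors a, (Ideal.absNorm p.asIdeal - 1)) *
        Ideal.absNorm (Ideal.span {a}) := by
  set I := Ideal.span {a} with hI
  set J := infPrimes (primeFactors a) with hJ
  have hI0 : I ≠ ⊥ := by simpa [hI] using ha
  have hJr : J = I.radical := infPrimes_primeFactors ha
  have hIJ : I ≤ J := hJr ▸ Ideal.le_radical
  have := finite_quotient hI0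
  have := finite_quotient (infPrimes_ne_bot (primeFactors a))
  let f : 𝓞 K ⧸ I →+* 𝓞 K ⧸ J := Ideal.Quotient.factor hIJ
  have hf : Function.Surjective f := Ideal.Quotient.factor_surjective hIJ
  have hker : IsNilpotent (RingHom.ker f) := by
    obtain ⟨n, hn⟩ := I.exists_radical_pow_le_of_fg (IsNoetherian.noetherian _)
    refine ⟨n, ?_⟩
    have h1 : RingHom.ker f = J.map (Ideal.Quotient.mk I) := Ideal.Quotient.factor_ker hIJ
    rw [h1, ← Ideal.map_pow, hJr, Ideal.zero_eq_bot, Ideal.map_eq_bot_iff_le_ker, Ideal.mk_ker]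
    exact hn
  -- the kernel of `f` is nilpotent, so `f` reflects units
  have hunit : ∀ x, IsUnit (f x) ↔ IsUnit x := by
    intro x
    rw [← IsNilpotent.isUnit_quotient_mk_iff hker]
    have h2 : f x = RingHom.quotientKerEquivOfSurjective hf (Ideal.Quotient.mk _ x) := rfl
    rw [h2, MulEquiv.isUnit_map]
  have h3 := card_preimage_mul_card f.toAddMonoidHom hf {y | IsUnit y}
  have h4 : Nat.card (f.toAddMonoidHom ⁻¹' {y | IsUnit y}) = Nat.card (𝓞 K ⧸ I)ˣ := by
    rw [← card_setOf_isUnit]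
    exact Nat.card_congr (Equiv.setCongr (Set.ext hunit))
  have h5 : Nat.card {y : 𝓞 K ⧸ J | IsUnit y} = Nat.card (𝓞 K ⧸ J)ˣ :=
    card_setOf_isUnit _
  rw [h4, h5, card_units_quotient_infPrimes, card_quotient_eq_absNorm,
    card_quotient_eq_absNorm] at h3
  rw [← h3, eulerPhiElem, eulerPhi, if_neg hI0]

open Classical in
/-- The local factor of `φ_K(a) / N(a)` at `p`: it is `1 - 1 / N(p)` if `p` divides `a`, and `1`
otherwise. -/
noncomputable def localRatio (p : HeightOneSpectrum (𝓞 K)) (a : 𝓞 K) : ℝ :=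
  if a ∈ p.asIdeal then 1 - 1 / (Ideal.absNorm p.asIdeal : ℝ) else 1

/-- The truncation of the Euler product of `φ_K(a) / N(a)` to a finite set of primes. -/
noncomputable def truncRatio (s : Finset (HeightOneSpectrum (𝓞 K))) (a : 𝓞 K) : ℝ :=
  ∏ p ∈ s, localRatio p a

theorem localRatio_nonneg (p : HeightOneSpectrum (𝓞 K)) (a : 𝓞 K) : 0 ≤ localRatio p a := by
  have h := two_le_absNorm_real p
  unfold localRatio
  split_ifs
  · rw [sub_nonneg, div_le_one (by linarith)]; linarith
  · exact zero_le_one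

theorem localRatio_le_one (p : HeightOneSpectrum (𝓞 K)) (a : 𝓞 K) : localRatio p a ≤ 1 := by
  unfold localRatio
  split_ifs
  · rw [sub_le_self_iff]; positivity
  · exact le_rfl

theorem truncRatio_nonneg (s : Finset (HeightOneSpectrum (𝓞 K))) (a : 𝓞 K) :
    0 ≤ truncRatio s a := Finset.prod_nonneg fun p _ => localRatio_nonneg p a

theorem truncRatio_le_one (s : Finset (HeightOneSpectrum (𝓞 K))) (a : 𝓞 K) :
    truncRatio s a ≤ 1 :=
  Finset.prod_le_one (fun p _ => localRatio_nonneg p a) fun p _ => localRatio_le_one p a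

/-- Euler's formula for `φ_K(a)`; primes of `t` that do not divide `a` contribute the factor `1`. -/
theorem eulerPhiElem_eq_truncRatio {a : 𝓞 K} (ha : a ≠ 0)
    {t : Finset (HeightOneSpectrum (𝓞 K))} (ht : primeFactors a ⊆ t) :
    (eulerPhiElem K a : ℝ) = Ideal.absNorm (Ideal.span {a}) * truncRatio t a := by
  have h1 : truncRatio t a = truncRatio (primeFactors a) a := by
    refine (Finset.prod_subset ht fun p _ hp => ?_).symm
    rw [mem_primeFactors ha] at hp
    simp [localRatio, hp]
  have h2 : (eulerPhiElem K a : ℝ) * ∏ p ∈ primeFactors a, (Ideal.absNorm p.asIdeal : ℝ) =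
      (∏ p ∈ primeFactors a, ((Ideal.absNorm p.asIdeal : ℝ) - 1)) *
        Ideal.absNorm (Ideal.span {a}) := by
    have h := congrArg (Nat.cast (R := ℝ)) (eulerPhiElem_mul_absNorm ha)
    rw [absNorm_infPrimes] at h
    push_cast at h
    rw [h]
    congr 1
    refine Finset.prod_congr rfl fun p _ => ?_
    rw [Nat.cast_sub (by have := two_le_absNorm p; omega), Nat.cast_one]
  have h3 : truncRatio (primeFactors a) a * ∏ p ∈ primeFactors a, (Ideal.absNorm p.asIdeal : ℝ) =
      ∏ p ∈ primeFactors a, ((Ideal.absNorm p.asIdeal : ℝ) - 1) := by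
    rw [truncRatio, ← Finset.prod_mul_distrib]
    refine Finset.prod_congr rfl fun p hp => ?_
    have := two_le_absNorm_real p
    rw [localRatio, if_pos ((mem_primeFactors ha).1 hp)]
    field_simp
  have h4 : ∏ p ∈ primeFactors a, (Ideal.absNorm p.asIdeal : ℝ) ≠ 0 :=
    Finset.prod_ne_zero_iff.2 fun p _ => by have := two_le_absNorm_real p; positivity
  rw [h1]
  refine mul_right_cancel₀ h4 ?_
  rw [h2, ← h3]
  ring

open Classical in
/-- Enlarging the set of primes from `s` to `t` lowers the truncated ratio at `a` by at most the sum
of `1 / N(p)` over the primes `p ∈ t \ s` that divide `a`. -/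
theorem truncRatio_le_of_subset {s t : Finset (HeightOneSpectrum (𝓞 K))} (hst : s ⊆ t) (a : 𝓞 K) :
    truncRatio t a ≤ truncRatio s a ∧ truncRatio s a ≤ truncRatio t a +
      ∑ p ∈ t \ s, if a ∈ p.asIdeal then 1 / (Ideal.absNorm p.asIdeal : ℝ) else 0 := by
  have h1 : truncRatio t a = truncRatio (t \ s) a * truncRatio s a :=
    (Finset.prod_sdiff hst).symm
  have h2 : 1 - ∑ p ∈ t \ s, (if a ∈ p.asIdeal then 1 / (Ideal.absNorm p.asIdeal : ℝ) else 0) ≤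
      truncRatio (t \ s) a := by
    refine (one_sub_sum_le_prod_one_sub _ _ (fun p _ => ?_) fun p _ => ?_).trans_eq ?_
    · split_ifs <;> positivity
    · have := two_le_absNorm_real p
      split_ifs
      · rw [div_le_one (by linarith)]; linarith
      · exact zero_le_one
    · refine Finset.prod_congr rfl fun p _ => ?_
      rw [localRatio]
      split_ifs <;> simp
  have h3 := truncRatio_le_one (t \ s) a
  have h4 := truncRatio_nonneg s a
  have h5 := truncRatio_le_one s a
  have h6 : 0 ≤ ∑ p ∈ t \ s, if a ∈ p.asIdeal then 1 / (Ideal.absNorm p.asIdeal : ℝ) else 0 :=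
    Finset.sum_nonneg fun p _ => by split_ifs <;> positivity
  rw [h1]
  constructor <;> nlinarith

/-- The value at `x ∈ 𝓞_K / p` of the local ratio at `p`. -/
noncomputable def residueRatio (p : HeightOneSpectrum (𝓞 K)) (x : 𝓞 K ⧸ p.asIdeal) : ℝ :=
  open Classical in if x = 0 then 1 - 1 / (Ideal.absNorm p.asIdeal : ℝ) else 1

theorem residueRatio_mk (p : HeightOneSpectrum (𝓞 K)) (a : 𝓞 K) :
    residueRatio p (Ideal.Quotient.mk _ a) = localRatio p a := by
  have h := Ideal.Quotient.eq_zero_iff_mem (I := p.asIdeal) (a := a)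
  by_cases ha : a ∈ p.asIdeal
  · rw [residueRatio, localRatio, if_pos (h.2 ha), if_pos ha]
  · rw [residueRatio, localRatio, if_neg (mt h.1 ha), if_neg ha]

/-- The density `1 - 2 / N(p)²` or `1 - 2 / N(p)² + 1 / N(p)³`, according to whether `p` divides
`k`, in product form. -/
noncomputable def localDensity (k : 𝓞 K) (p : HeightOneSpectrum (𝓞 K)) : ℝ :=
  open Classical in
  mainFactor K p * if p.asIdeal ∣ Ideal.span {k} then divisorFactor K p else 1

/-- The mean value over `𝓞 K ⧸ p` of the product of the local ratios at `x` and `x + k` is the local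
density. -/
theorem sum_residueRatio (k : 𝓞 K) (p : HeightOneSpectrum (𝓞 K)) [Fintype (𝓞 K ⧸ p.asIdeal)] :
    ∑ x, residueRatio p x * residueRatio p (x + Ideal.Quotient.mk _ k) =
      Ideal.absNorm p.asIdeal * localDensity k p := by
  classical
  have hq := two_le_absNorm_real p
  set q : ℝ := (Ideal.absNorm p.asIdeal : ℝ) with hqd
  have hcard : ((Finset.univ : Finset (𝓞 K ⧸ p.asIdeal)).card : ℝ) = q := by
    rw [Finset.card_univ, ← Nat.card_eq_fintype_card, card_quotient_eq_absNorm]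
  set κ : 𝓞 K ⧸ p.asIdeal := Ideal.Quotient.mk _ k with hκ
  have hdvd : p.asIdeal ∣ Ideal.span {k} ↔ κ = 0 := by
    rw [Ideal.dvd_span_singleton, hκ, Ideal.Quotient.eq_zero_iff_mem]
  have hq2 : q ^ 2 - 2 ≠ 0 := by nlinarith
  have hsum : ∀ c d : ℝ, ∀ y : 𝓞 K ⧸ p.asIdeal, ∑ x, (if x = y then c else d) =
      c + (q - 1) * d := by
    intro c d y
    rw [← Finset.add_sum_erase _ _ (Finset.mem_univ y), if_pos rfl,
      Finset.sum_congr rfl (g := fun _ => d) fun x hx => if_neg (Finset.ne_of_mem_erase hx),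
      Finset.sum_const, nsmul_eq_mul, Finset.card_erase_of_mem (Finset.mem_univ y),
      Nat.cast_sub (Finset.card_pos.2 ⟨y, Finset.mem_univ y⟩), hcard, Nat.cast_one]
  rw [localDensity, mainFactor, divisorFactor, ← hqd]
  by_cases hk : κ = 0
  · rw [if_pos (hdvd.2 hk), hk]
    have e : ∀ x : 𝓞 K ⧸ p.asIdeal, residueRatio p x * residueRatio p (x + 0) =
        if x = 0 then (1 - 1 / q) ^ 2 else 1 := by
      intro x
      simp only [residueRatio, add_zero, ← hqd]
      split_ifs <;> ring
    simp_rw [e]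
    rw [hsum]
    field_simp
    ring
  · rw [if_neg (fun h => hk (hdvd.1 h))]
    -- one of the two factors is `1`, so the product is their sum minus `1`
    have e : ∀ x : 𝓞 K ⧸ p.asIdeal, residueRatio p x * residueRatio p (x + κ) =
        (if x = 0 then 1 - 1 / q else 1) + ((if x = -κ then 1 - 1 / q else 1) + (-1)) := by
      intro x
      simp only [residueRatio, ← hqd, add_eq_zero_iff_eq_neg]
      by_cases h1 : x = 0
      · have h2 : x ≠ -κ := by rw [h1]; exact fun h => hk (neg_eq_zero.1 h.symm)
        rw [if_pos h1, if_neg h2]; ring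
      · rw [if_neg h1]; ring
    simp_rw [e]
    rw [Finset.sum_add_distrib, Finset.sum_add_distrib, hsum, hsum, Finset.sum_const, nsmul_eq_mul,
      hcard]
    field_simp
    ring

/-- The mean value of the `infPrimes s`-periodic function
`a ↦ truncRatio s a * truncRatio s (a + k)` is the product of the local densities. -/
theorem sum_truncRatio_quotient (k : 𝓞 K) (s : Finset (HeightOneSpectrum (𝓞 K)))
    [Fintype (𝓞 K ⧸ infPrimes s)] :
    ∑ x : 𝓞 K ⧸ infPrimes s, truncRatio s x.out * truncRatio s (x.out + k) =
      Ideal.absNorm (infPrimes s) * ∏ p ∈ s, localDensity k p := by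
  classical
  have hfin : ∀ p : s, Fintype (𝓞 K ⧸ p.1.asIdeal) := fun p =>
    have := finite_quotient p.1.ne_bot
    Fintype.ofFinite _
  let F : (∀ p : s, 𝓞 K ⧸ p.1.asIdeal) → ℝ := fun y =>
    ∏ p : s, residueRatio p.1 (y p) * residueRatio p.1 (y p + Ideal.Quotient.mk _ k)
  have h1 : ∀ x : 𝓞 K ⧸ infPrimes s, truncRatio s x.out * truncRatio s (x.out + k) =
      F (quotientInfPrimesEquiv s x) := by
    intro x
    have hx : x = Ideal.Quotient.mk _ x.out := (Ideal.Quotient.mk_out x).symm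
    simp only [F, truncRatio]
    rw [← Finset.prod_mul_distrib, ← Finset.prod_coe_sort s]
    refine Finset.prod_congr rfl fun p _ => ?_
    conv_rhs => rw [hx]
    rw [quotientInfPrimesEquiv_mk, ← map_add, residueRatio_mk, residueRatio_mk]
  simp_rw [h1]
  rw [Function.Bijective.sum_comp (quotientInfPrimesEquiv s).bijective F, absNorm_infPrimes]
  simp only [F]
  rw [← Fintype.piFinset_univ, ← Finset.prod_univ_sum (fun _ => Finset.univ)
    fun (p : s) x => residueRatio p.1 x * residueRatio p.1 (x + Ideal.Quotient.mk _ k)]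
  simp_rw [sum_residueRatio]
  rw [Finset.prod_mul_distrib, Finset.prod_coe_sort s fun p => (Ideal.absNorm p.asIdeal : ℝ),
    Finset.prod_coe_sort s fun p => localDensity k p]
  push_cast
  rfl

theorem truncRatio_add_mul {s : Finset (HeightOneSpectrum (𝓞 K))} {m : 𝓞 K}
    (hm : m ∈ infPrimes s) (a b : 𝓞 K) : truncRatio s (a + m * b) = truncRatio s a := by
  refine Finset.prod_congr rfl fun p hp => ?_
  have h := p.asIdeal.mul_mem_right b (mem_infPrimes.1 hm p hp)
  rw [← residueRatio_mk, ← residueRatio_mk, map_add, Ideal.Quotient.eq_zero_iff_mem.2 h, add_zero]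

end Arithmetic

/-! ### Truncated sums and the truncation error -/

/-- Splitting of a sum over a domain `R` according to residue classes modulo `I = (m)`. -/
theorem tsum_eq_sum_quotient_tsum {R : Type*} [CommRing R] [IsDomain R] {m : R} (hm : m ≠ 0)
    {I : Ideal R} (hI : I = Ideal.span {m}) [Fintype (R ⧸ I)] (G : R → ℝ) (hG : Summable G) :
    ∑' a, G a = ∑ q : R ⧸ I, ∑' b, G (q.out + m * b) := by
  have hmI : m ∈ I := hI ▸ Ideal.mem_span_singleton_self m
  have hdvd : ∀ c ∈ I, m ∣ c := fun c hc => Ideal.mem_span_singleton.1 (hI ▸ hc)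
  have hbij : Function.Bijective fun y : (R ⧸ I) × R => y.1.out + m * y.2 := by
    have hmk : ∀ y : (R ⧸ I) × R, Ideal.Quotient.mk I (y.1.out + m * y.2) = y.1 := by
      intro y
      have h : Ideal.Quotient.mk I (m * y.2) = 0 := by
        rw [Ideal.Quotient.eq_zero_iff_mem]
        exact Ideal.mul_mem_right _ _ hmI
      rw [map_add, h, add_zero, Ideal.Quotient.mk_out]
    constructor
    · intro y y' h
      have h1 : y.1 = y'.1 := by
        rw [← hmk y, ← hmk y']; exact congrArg _ h
      have h2 : y.1.out + m * y.2 = y'.1.out + m * y'.2 := h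
      rw [h1, add_right_inj] at h2
      exact Prod.ext h1 (mul_left_cancel₀ hm h2)
    · intro a
      have h : a - (Ideal.Quotient.mk I a).out ∈ I := by
        rw [← Ideal.Quotient.eq, Ideal.Quotient.mk_out]
      obtain ⟨b, hb⟩ := hdvd _ h
      exact ⟨(Ideal.Quotient.mk I a, b), by linear_combination -hb⟩
  let e := Equiv.ofBijective _ hbij
  have h1 : Summable fun y => G (e y) := (e.summable_iff).2 hG
  rw [← e.tsum_eq, h1.tsum_prod, tsum_fintype]
  rfl

section Sums

open IsDedekindDomain

variable {K : Type*} [Field K] [NumberField K] [Algebra.IsQuadraticExtension ℚ K]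
  [NumberField.IsTotallyComplex K] (σ : K →+* ℂ)

theorem norm_le_of_mem_sector {z w : ℂ} (hz : z ≠ 0) {θ x : ℝ} (hw : w ∈ sector z θ x) :
    w ≠ 0 ∧ ‖w‖ ≤ x := by
  obtain ⟨t, ρ, -, -, h0, h1, rfl⟩ := hw
  have hn := norm_pos_iff.2 hz
  refine ⟨?_, ?_⟩
  · exact mul_ne_zero (mul_ne_zero (by exact_mod_cast h0.ne') (Complex.exp_ne_zero _)) hz
  · rw [norm_mul, norm_mul, Complex.norm_exp_ofReal_mul_I, Complex.norm_real,
      Real.norm_of_nonneg h0.le, mul_one]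
    rwa [le_div_iff₀ hn] at h1

theorem finite_sectorIntegers {z : ℂ} (hz : z ≠ 0) (θ x : ℝ) :
    (sectorIntegers K σ z θ x).Finite :=
  (finite_setOf_norm_map_le σ x).subset fun _ ha => (norm_le_of_mem_sector hz ha).2

/-- The asymptotic formula for the sums in which `φ_K(a) / N(a)` is replaced by its truncation to a
fixed finite set `s` of primes. -/
theorem tendsto_truncated_sum [IsPrincipalIdealRing (𝓞 K)] {z : ℂ} (hz : z ≠ 0) {θ : ℝ}
    (hθ : 0 < θ) (hθ' : θ ≤ 2 * Real.pi) (k : 𝓞 K) (s : Finset (HeightOneSpectrum (𝓞 K))) :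
    Tendsto (fun x : ℝ => (∑ a ∈ (finite_sectorIntegers σ hz θ x).toFinset,
      (Ideal.absNorm (Ideal.span {a}) * truncRatio s a) *
        (Ideal.absNorm (Ideal.span {a + k}) * truncRatio s (a + k))) / x ^ 6) atTop
      (𝓝 (θ / (3 * √|(NumberField.discr K : ℝ)|) * ∏ p ∈ s, localDensity k p)) := by
  classical
  obtain ⟨m, hm⟩ := (IsPrincipalIdealRing.principal (infPrimes s)).principal
  have hI : infPrimes s = Ideal.span {m} := hm
  have hm0 : m ≠ 0 := by
    rintro rfl
    exact infPrimes_ne_bot s (by rw [hI]; simp)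
  have hσm : σ m ≠ 0 := by
    rw [Ne, map_eq_zero, NumberField.RingOfIntegers.coe_eq_zero_iff]; exact hm0
  have hmem : m ∈ infPrimes s := by rw [hI]; exact Ideal.mem_span_singleton_self m
  have := finite_quotient (infPrimes_ne_bot s)
  have := Fintype.ofFinite (𝓞 K ⧸ infPrimes s)
  have hnorm : ‖σ m‖ ^ 2 = (Ideal.absNorm (infPrimes s) : ℝ) := by
    rw [hI, absNorm_span_singleton_eq σ]
  have hn0 : (Ideal.absNorm (infPrimes s) : ℝ) ≠ 0 := by
    rw [← hnorm]; exact pow_ne_zero _ (norm_ne_zero_iff.2 hσm)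
  -- sum over the residue classes the asymptotics in each class
  have key := tendsto_finsetSum (Finset.univ : Finset (𝓞 K ⧸ infPrimes s)) fun q _ =>
    (tendsto_sum_sector_coset σ hz hθ hθ' hσm (σ q.out) (σ k)).const_mul
      (truncRatio s q.out * truncRatio s (q.out + k))
  rw [← Finset.sum_mul, sum_truncRatio_quotient, hnorm] at key
  refine (key.congr fun x => ?_).trans_eq ?_
  · let G : 𝓞 K → ℝ := fun a => if σ a ∈ sector z θ x then
      (Ideal.absNorm (Ideal.span {a}) * truncRatio s a) *
        (Ideal.absNorm (Ideal.span {a + k}) * truncRatio s (a + k)) else 0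
    have hG0 : ∀ a ∉ (finite_sectorIntegers σ hz θ x).toFinset, G a = 0 := by
      intro a ha
      rw [Set.Finite.mem_toFinset] at ha
      exact if_neg ha
    have hG : Summable G := summable_of_ne_finset_zero hG0
    have h1 : ∑ a ∈ (finite_sectorIntegers σ hz θ x).toFinset,
      (Ideal.absNorm (Ideal.span {a}) * truncRatio s a) *
        (Ideal.absNorm (Ideal.span {a + k}) * truncRatio s (a + k)) = ∑' a, G a := by
      rw [tsum_eq_sum hG0]
      refine Finset.sum_congr rfl fun a ha => ?_
      rw [Set.Finite.mem_toFinset] at ha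
      exact (if_pos ha).symm
    rw [h1, tsum_eq_sum_quotient_tsum hm0 hI G hG, Finset.sum_div]
    refine Finset.sum_congr rfl fun q _ => ?_
    rw [← mul_div_assoc, ← tsum_mul_left]
    congr 1
    refine tsum_congr fun b => ?_
    have e1 : σ ((q.out + m * b : 𝓞 K) : K) = σ q.out + σ m * σ b := by simp
    have e2 : σ ((q.out + m * b + k : 𝓞 K) : K) = σ q.out + σ m * σ b + σ k := by simp
    have e3 : truncRatio s (q.out + m * b + k) = truncRatio s (q.out + k) := by
      rw [add_right_comm, truncRatio_add_mul hmem]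
    simp only [G]
    rw [absNorm_span_singleton_eq σ, absNorm_span_singleton_eq σ, e1, e2,
      truncRatio_add_mul hmem, e3]
    split_ifs
    · ring
    · exact mul_zero _
  · congr 1
    field_simp

theorem exists_norm_eq_of_prime [IsPrincipalIdealRing (𝓞 K)] (p : HeightOneSpectrum (𝓞 K)) :
    ∃ π : 𝓞 K, p.asIdeal = Ideal.span {π} ∧ ‖σ π‖ ^ 2 = Ideal.absNorm p.asIdeal := by
  obtain ⟨π, hπ⟩ := (IsPrincipalIdealRing.principal p.asIdeal).principal
  have h : p.asIdeal = Ideal.span {π} := hπ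
  exact ⟨π, h, by rw [h, absNorm_span_singleton_eq σ]⟩

include σ in
theorem summable_inv_absNorm_sq [IsPrincipalIdealRing (𝓞 K)] :
    Summable fun p : HeightOneSpectrum (𝓞 K) => 1 / (Ideal.absNorm p.asIdeal : ℝ) ^ 2 := by
  choose π hπ hn using exists_norm_eq_of_prime (K := K) σ
  have hinj : Function.Injective π := fun p q h => HeightOneSpectrum.ext (by rw [hπ p, hπ q, h])
  refine ((summable_inv_norm_map_pow_four σ).comp_injective hinj).congr fun p => ?_
  rw [Function.comp_apply, ← hn, one_div, ← pow_mul]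

/-- The truncation error, uniformly in the set `s` of primes: if all finite partial sums of
`∑ 1 / N(p) ^ 2` away from `s` are at most `ε`, the error is at most `C * ε * x ^ 6`. -/
theorem exists_sum_eulerPhi_sub_truncated_le [IsPrincipalIdealRing (𝓞 K)] {z : ℂ} (hz : z ≠ 0)
    (θ : ℝ) (k : 𝓞 K) :
    ∃ C : ℝ, 0 < C ∧ ∀ (s : Finset (HeightOneSpectrum (𝓞 K))) (ε : ℝ),
      (∀ t : Finset (HeightOneSpectrum (𝓞 K)), Disjoint t s →
        ∑ p ∈ t, 1 / (Ideal.absNorm p.asIdeal : ℝ) ^ 2 ≤ ε) →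
      ∀ x : ℝ, 0 < x → ‖σ k‖ ≤ x →
        |∑ a ∈ (finite_sectorIntegers σ hz θ x).toFinset,
            (eulerPhiElem K a : ℝ) * eulerPhiElem K (a + k) -
          ∑ a ∈ (finite_sectorIntegers σ hz θ x).toFinset,
            (Ideal.absNorm (Ideal.span {a}) * truncRatio s a) *
              (Ideal.absNorm (Ideal.span {a + k}) * truncRatio s (a + k))| ≤ C * ε * x ^ 6 := by
  classical
  obtain ⟨C, hC, hcount⟩ := exists_ncard_norm_map_le (K := K) σ
  refine ⟨32 * C, by positivity, fun s ε hs x hx hkx => ?_⟩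
  set S := (finite_sectorIntegers σ hz θ x).toFinset with hSdef
  have hTfin : {b : 𝓞 K | b ≠ 0 ∧ ‖σ b‖ ≤ 2 * x}.Finite :=
    (finite_setOf_norm_map_le σ (2 * x)).subset fun a ha => ha.2
  set T := hTfin.toFinset with hTdef
  have hT : ∀ b : 𝓞 K, b ∈ T ↔ b ≠ 0 ∧ ‖σ b‖ ≤ 2 * x := fun b => by
    rw [hTdef, Set.Finite.mem_toFinset]; rfl
  have hS : ∀ a ∈ S, a ≠ 0 ∧ ‖σ a‖ ≤ x := by
    intro a ha
    rw [hSdef, Set.Finite.mem_toFinset] at ha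
    have h := norm_le_of_mem_sector hz ha
    refine ⟨?_, h.2⟩
    rintro rfl
    exact h.1 (by simp)
  have hSk : ∀ a ∈ S, ‖σ ((a + k : 𝓞 K) : K)‖ ≤ 2 * x := by
    intro a ha
    have h1 := (hS a ha).2
    have h2 : σ ((a + k : 𝓞 K) : K) = σ a + σ k := by simp
    rw [h2]
    exact (norm_add_le _ _).trans (by linarith)
  let t := s ∪ T.biUnion primeFactors
  have hst : s ⊆ t := Finset.subset_union_left
  -- for the elements in play, the truncation at `t` is the full Euler product
  have hphi : ∀ b : 𝓞 K, ‖σ b‖ ≤ 2 * x →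
      (eulerPhiElem K b : ℝ) = Ideal.absNorm (Ideal.span {b}) * truncRatio t b := by
    intro b hb
    by_cases h0 : b = 0
    · simp [h0, eulerPhiElem, eulerPhi]
    · refine eulerPhiElem_eq_truncRatio h0 (fun p hp => ?_)
      exact Finset.mem_union_right _ (Finset.mem_biUnion.2 ⟨b, (hT b).2 ⟨h0, hb⟩, hp⟩)
  -- at `b = 0` no bound is needed, because `N(0) = 0 = φ_K(0)`
  let δ : 𝓞 K → ℝ := fun b => if b = 0 then 0 else
    ∑ p ∈ t \ s, if b ∈ p.asIdeal then 1 / (Ideal.absNorm p.asIdeal : ℝ) else 0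
  have hδ0 : ∀ b, 0 ≤ δ b := by
    intro b
    simp only [δ]
    split_ifs
    · exact le_rfl
    · exact Finset.sum_nonneg fun p _ => by split_ifs <;> positivity
  -- multiples of a generator of `p` of modulus at most `2 * x`
  have hprime : ∀ p : HeightOneSpectrum (𝓞 K),
      ((T.filter fun b => b ∈ p.asIdeal).card : ℝ) ≤
        C * (4 * x ^ 2) / Ideal.absNorm p.asIdeal := by
    intro p
    obtain ⟨π, hπ, hn⟩ := exists_norm_eq_of_prime σ p
    have hN := two_le_absNorm_real p
    have hπ0 : 0 < ‖σ π‖ := by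
      rcases (norm_nonneg (σ π)).lt_or_eq with h | h
      · exact h
      · rw [← h] at hn; norm_num at hn; linarith
    have hfin : {c : 𝓞 K | c ≠ 0 ∧ ‖σ c‖ ≤ 2 * x / ‖σ π‖}.Finite :=
      (finite_setOf_norm_map_le σ _).subset fun a ha => ha.2
    have h1 : (T.filter fun b => b ∈ p.asIdeal).card ≤
        {c : 𝓞 K | c ≠ 0 ∧ ‖σ c‖ ≤ 2 * x / ‖σ π‖}.ncard := by
      rw [Set.ncard_eq_toFinset_card _ hfin]
      refine (Finset.card_le_card (t := hfin.toFinset.image (π * ·)) fun b hb => ?_).trans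
        Finset.card_image_le
      rw [Finset.mem_filter, hT, hπ, Ideal.mem_span_singleton] at hb
      obtain ⟨⟨hb0, hbx⟩, c, rfl⟩ := hb
      refine Finset.mem_image.2 ⟨c, ?_, rfl⟩
      rw [Set.Finite.mem_toFinset]
      refine ⟨right_ne_zero_of_mul hb0, ?_⟩
      rw [le_div_iff₀ hπ0, mul_comm, ← norm_mul]
      simpa using hbx
    calc ((T.filter fun b => b ∈ p.asIdeal).card : ℝ)
        ≤ ({c : 𝓞 K | c ≠ 0 ∧ ‖σ c‖ ≤ 2 * x / ‖σ π‖}.ncard : ℝ) := by exact_mod_cast h1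
      _ ≤ C * (2 * x / ‖σ π‖) ^ 2 := hcount _ (by positivity)
      _ = _ := by rw [div_pow, hn]; ring
  have hδT : ∑ b ∈ T, δ b ≤ 4 * C * x ^ 2 * ε := by
    have e1 : ∀ b ∈ T, δ b =
        ∑ p ∈ t \ s, if b ∈ p.asIdeal then 1 / (Ideal.absNorm p.asIdeal : ℝ) else 0 :=
      fun b hb => if_neg ((hT b).1 hb).1
    rw [Finset.sum_congr rfl e1, Finset.sum_comm]
    calc ∑ p ∈ t \ s, ∑ b ∈ T, (if b ∈ p.asIdeal then 1 / (Ideal.absNorm p.asIdeal : ℝ) else 0)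
        ≤ ∑ p ∈ t \ s, 4 * C * x ^ 2 * (1 / (Ideal.absNorm p.asIdeal : ℝ) ^ 2) := by
          refine Finset.sum_le_sum fun p _ => ?_
          have hN := two_le_absNorm_real p
          rw [← Finset.sum_filter, Finset.sum_const, nsmul_eq_mul]
          calc _ ≤ C * (4 * x ^ 2) / Ideal.absNorm p.asIdeal *
                (1 / (Ideal.absNorm p.asIdeal : ℝ)) := by
                gcongr
                exact hprime p
            _ = _ := by field_simp
      _ ≤ _ := by
          rw [← Finset.mul_sum]
          gcongr
          exact hs _ Finset.sdiff_disjoint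
  have hδS : ∑ a ∈ S, δ a ≤ 4 * C * x ^ 2 * ε := by
    refine (Finset.sum_le_sum_of_subset_of_nonneg (fun a ha => ?_) fun b _ _ => hδ0 b).trans hδT
    have h := hS a ha
    exact (hT a).2 ⟨h.1, by linarith [h.2]⟩
  -- the term with `a + k = 0` vanishes, and the others are reindexed by `b = a + k`
  have hδSk : ∑ a ∈ S, δ (a + k) ≤ 4 * C * x ^ 2 * ε := by
    rw [← Finset.sum_filter_add_sum_filter_not S (fun a => a + k = 0)]
    rw [Finset.sum_eq_zero (s := S.filter fun a => a + k = 0) fun a ha => by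
      simp [δ, (Finset.mem_filter.1 ha).2], zero_add]
    rw [← Finset.sum_image (g := fun a => a + k) (f := δ)
      (fun a _ b _ h => add_right_cancel h)]
    refine (Finset.sum_le_sum_of_subset_of_nonneg (fun b hb => ?_) fun b _ _ => hδ0 b).trans hδT
    obtain ⟨a, ha, rfl⟩ := Finset.mem_image.1 hb
    rw [Finset.mem_filter] at ha
    exact (hT _).2 ⟨ha.2, hSk a ha.1⟩
  have hterm : ∀ a ∈ S, |(eulerPhiElem K a : ℝ) * eulerPhiElem K (a + k) -
      (Ideal.absNorm (Ideal.span {a}) * truncRatio s a) *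
        (Ideal.absNorm (Ideal.span {a + k}) * truncRatio s (a + k))| ≤
      4 * x ^ 4 * (δ a + δ (a + k)) := by
    intro a ha
    have hx0 := hS a ha
    have hxk := hSk a ha
    rw [hphi a (by linarith [hx0.2]), hphi _ hxk]
    have hA : (Ideal.absNorm (Ideal.span {a}) : ℝ) ≤ x ^ 2 := by
      rw [absNorm_span_singleton_eq σ]
      exact pow_le_pow_left₀ (norm_nonneg _) hx0.2 2
    have hB : (Ideal.absNorm (Ideal.span {a + k}) : ℝ) ≤ 4 * x ^ 2 := by
      rw [absNorm_span_singleton_eq σ]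
      calc _ ≤ (2 * x) ^ 2 := pow_le_pow_left₀ (norm_nonneg _) hxk 2
        _ = _ := by ring
    by_cases hk0 : a + k = 0
    · have : 0 ≤ 4 * x ^ 4 * (δ a + δ (a + k)) :=
        mul_nonneg (by positivity) (add_nonneg (hδ0 _) (hδ0 _))
      simpa [hk0] using this
    have h1 := truncRatio_le_of_subset hst a
    have h2 := truncRatio_le_of_subset hst (a + k)
    have e1 : (∑ p ∈ t \ s, if a ∈ p.asIdeal then 1 / (Ideal.absNorm p.asIdeal : ℝ) else 0) =
      δ a := (if_neg hx0.1).symm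
    have e2 : (∑ p ∈ t \ s, if a + k ∈ p.asIdeal then 1 / (Ideal.absNorm p.asIdeal : ℝ) else 0) =
      δ (a + k) := (if_neg hk0).symm
    rw [e1] at h1
    rw [e2] at h2
    have n1 := truncRatio_nonneg t a
    have n2 := truncRatio_nonneg t (a + k)
    have l1 := truncRatio_le_one s (a + k)
    have l2 := truncRatio_le_one t a
    have l3 := truncRatio_nonneg s (a + k)
    have d1 := hδ0 a
    have d2 := hδ0 (a + k)
    set A : ℝ := (Ideal.absNorm (Ideal.span {a}) : ℝ)
    set B : ℝ := (Ideal.absNorm (Ideal.span {a + k}) : ℝ)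
    have hA0 : 0 ≤ A := Nat.cast_nonneg _
    have hB0 : 0 ≤ B := Nat.cast_nonneg _
    have h3 : 0 ≤ truncRatio s a * truncRatio s (a + k) - truncRatio t a * truncRatio t (a + k) :=
      sub_nonneg.2 (mul_le_mul h1.1 h2.1 n2 (n1.trans h1.1))
    have h4 : truncRatio s a * truncRatio s (a + k) - truncRatio t a * truncRatio t (a + k) ≤
        δ a + δ (a + k) := by
      have i1 : (truncRatio s a - truncRatio t a) * truncRatio s (a + k) ≤ δ a * 1 :=
        mul_le_mul (by linarith [h1.2]) l1 l3 d1
      have i2 : truncRatio t a * (truncRatio s (a + k) - truncRatio t (a + k)) ≤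
          1 * δ (a + k) :=
        mul_le_mul l2 (by linarith [h2.2]) (sub_nonneg.2 h2.1) zero_le_one
      linarith
    rw [abs_sub_comm, show A * truncRatio s a * (B * truncRatio s (a + k)) -
        A * truncRatio t a * (B * truncRatio t (a + k)) = A * B *
        (truncRatio s a * truncRatio s (a + k) - truncRatio t a * truncRatio t (a + k)) by ring,
      abs_of_nonneg (mul_nonneg (mul_nonneg hA0 hB0) h3)]
    have h5 : A * B ≤ 4 * x ^ 4 := by
      calc A * B ≤ x ^ 2 * (4 * x ^ 2) := mul_le_mul hA hB hB0 (by positivity)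
        _ = _ := by ring
    exact mul_le_mul h5 h4 h3 (by positivity)
  rw [← Finset.sum_sub_distrib]
  calc _ ≤ ∑ a ∈ S, 4 * x ^ 4 * (δ a + δ (a + k)) :=
        (Finset.abs_sum_le_sum_abs _ _).trans (Finset.sum_le_sum hterm)
    _ = 4 * x ^ 4 * (∑ a ∈ S, δ a + ∑ a ∈ S, δ (a + k)) := by
        rw [← Finset.mul_sum, Finset.sum_add_distrib]
    _ ≤ 4 * x ^ 4 * (4 * C * x ^ 2 * ε + 4 * C * x ^ 2 * ε) := by gcongr
    _ = _ := by ring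

end Sums

/-! ### Convergence of the Euler products and passage to the limit -/

section EulerProducts

open IsDedekindDomain

variable {K : Type*} [Field K] [NumberField K]

theorem mainFactor_pos (p : HeightOneSpectrum (𝓞 K)) : 0 < mainFactor K p := by
  have h := two_le_absNorm_real p
  rw [mainFactor, sub_pos, div_lt_one (by positivity)]
  nlinarith

theorem divisorFactor_sub_one_bounds (p : HeightOneSpectrum (𝓞 K)) :
    0 ≤ divisorFactor K p - 1 ∧
      divisorFactor K p - 1 ≤ 1 / (Ideal.absNorm p.asIdeal : ℝ) ^ 2 := by
  have h := two_le_absNorm_real p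
  set q : ℝ := (Ideal.absNorm p.asIdeal : ℝ) with hq
  have h1 : q ≤ q ^ 2 - 2 := by nlinarith
  rw [divisorFactor, ← hq, add_sub_cancel_left]
  constructor
  · have : 0 ≤ q ^ 2 - 2 := by linarith
    positivity
  · refine one_div_le_one_div_of_le (by positivity) ?_
    nlinarith

variable (hsum : Summable fun p : HeightOneSpectrum (𝓞 K) =>
  1 / (Ideal.absNorm p.asIdeal : ℝ) ^ 2)

include hsum

theorem summable_norm_mainFactor_sub_one :
    Summable fun p : HeightOneSpectrum (𝓞 K) => ‖mainFactor K p - 1‖ := by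
  refine (hsum.mul_left 2).congr fun p => ?_
  rw [mainFactor, sub_sub_cancel_left, norm_neg, Real.norm_of_nonneg (by positivity)]
  ring

theorem summable_norm_divisorFactor_sub_one (k : 𝓞 K) :
    Summable fun p : PrimeDivisor K k => ‖divisorFactor K p.1 - 1‖ := by
  refine Summable.of_nonneg_of_le (fun _ => norm_nonneg _) (fun p => ?_)
    (hsum.comp_injective Subtype.val_injective)
  have h := divisorFactor_sub_one_bounds p.1
  rw [Real.norm_of_nonneg h.1]
  exact h.2

theorem multipliable_mainFactor : Multipliable (mainFactor K) := by
  have h := multipliable_one_add_of_summable (summable_norm_mainFactor_sub_one hsum)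
  simpa using h

theorem multipliable_divisorFactor (k : 𝓞 K) :
    Multipliable fun p : PrimeDivisor K k => divisorFactor K p.1 := by
  have h := multipliable_one_add_of_summable (summable_norm_divisorFactor_sub_one hsum k)
  simpa using h

theorem tprod_mainFactor_ne_zero : ∏' p, mainFactor K p ≠ 0 := by
  have h := tprod_one_add_ne_zero_of_summable (f := fun p => mainFactor K p - 1)
    (fun p => by rw [add_sub_cancel]; exact (mainFactor_pos p).ne')
    (summable_norm_mainFactor_sub_one hsum)
  simpa using h

theorem tprod_divisorFactor_ne_zero (k : 𝓞 K) :
    ∏' p : PrimeDivisor K k, divisorFactor K p.1 ≠ 0 := by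
  have h := tprod_one_add_ne_zero_of_summable (f := fun p : PrimeDivisor K k =>
      divisorFactor K p.1 - 1)
    (fun p => by
      have := (divisorFactor_sub_one_bounds p.1).1
      linarith)
    (summable_norm_divisorFactor_sub_one hsum k)
  simpa using h

theorem hasProd_localDensity (k : 𝓞 K) : HasProd (localDensity k)
    ((∏' p, mainFactor K p) * ∏' p : PrimeDivisor K k, divisorFactor K p.1) := by
  classical
  have h1 := (multipliable_mainFactor hsum).hasProd
  have h2 : HasProd (fun p : PrimeDivisor K k => divisorFactor K p.1)
    (∏' p : PrimeDivisor K k, divisorFactor K p.1) := (multipliable_divisorFactor hsum k).hasProd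
  have h3 := (hasProd_subtype_iff_mulIndicator (f := divisorFactor K)
    (s := {p : HeightOneSpectrum (𝓞 K) | p.asIdeal ∣ Ideal.span {k}})).1 h2
  convert h1.mul h3 using 1
  funext p
  simp [localDensity, Set.mulIndicator_apply]

end EulerProducts

/-- The asymptotic formula for the sums of the products `φ_K(a) φ_K(a + k)`, with the constant
expressed through the product of the local densities. -/
theorem tendsto_sum_eulerPhi {K : Type*} [Field K] [NumberField K]
    [Algebra.IsQuadraticExtension ℚ K] [NumberField.IsTotallyComplex K]
    [IsPrincipalIdealRing (𝓞 K)] (σ : K →+* ℂ)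
    {z : ℂ} (hz : z ≠ 0) {θ : ℝ} (hθ : 0 < θ) (hθ' : θ ≤ 2 * Real.pi) (k : 𝓞 K) {P : ℝ}
    (hP : HasProd (localDensity k) P) :
    Tendsto (fun x : ℝ => (∑ a ∈ (finite_sectorIntegers σ hz θ x).toFinset,
      (eulerPhiElem K a : ℝ) * eulerPhiElem K (a + k)) / x ^ 6) atTop
      (𝓝 (θ / (3 * √|(NumberField.discr K : ℝ)|) * P)) := by
  obtain ⟨C, hC, herr⟩ := exists_sum_eulerPhi_sub_truncated_le (K := K) σ hz θ k
  set c := θ / (3 * √|(NumberField.discr K : ℝ)|)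
  have hcP : Tendsto (fun s => c * ∏ p ∈ s, localDensity k p) atTop (𝓝 (c * P)) :=
    Tendsto.const_mul c hP
  rw [Metric.tendsto_nhds]
  intro ε hε
  have hη : 0 < ε / (3 * C) := by positivity
  obtain ⟨s₁, hs₁⟩ := (summable_iff_vanishing_norm.1 (summable_inv_absNorm_sq σ)) _ hη
  obtain ⟨s₂, hs₂⟩ := eventually_atTop.1 ((Metric.tendsto_nhds.1 hcP) (ε / 3) (by positivity))
  classical
  let s := s₁ ∪ s₂
  have h1 : dist (c * ∏ p ∈ s, localDensity k p) (c * P) < ε / 3 :=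
    hs₂ s Finset.subset_union_right
  have h2 := herr s (ε / (3 * C)) fun t ht =>
    (le_abs_self _).trans (hs₁ t (ht.mono_right Finset.subset_union_left)).le
  have h3 := (Metric.tendsto_nhds.1 (tendsto_truncated_sum σ hz hθ hθ' k s)) (ε / 3)
    (by positivity)
  filter_upwards [h3, eventually_gt_atTop 0, eventually_ge_atTop ‖σ k‖] with x h4 hx hkx
  have h5 := h2 x hx hkx
  set U := ∑ a ∈ (finite_sectorIntegers σ hz θ x).toFinset,
      (eulerPhiElem K a : ℝ) * eulerPhiElem K (a + k)
  set V := ∑ a ∈ (finite_sectorIntegers σ hz θ x).toFinset,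
      (Ideal.absNorm (Ideal.span {a}) * truncRatio s a) *
        (Ideal.absNorm (Ideal.span {a + k}) * truncRatio s (a + k))
  have h6 : dist (U / x ^ 6) (V / x ^ 6) ≤ ε / 3 := by
    rw [Real.dist_eq, ← sub_div, abs_div, abs_of_pos (by positivity : 0 < x ^ 6),
      div_le_iff₀ (by positivity)]
    refine h5.trans_eq ?_
    field_simp
  have h7 := dist_triangle (U / x ^ 6) (V / x ^ 6) (c * P)
  have h8 := dist_triangle (V / x ^ 6) (c * ∏ p ∈ s, localDensity k p) (c * P)
  linarith

end SectorialMirsky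

/-- The first conjunct says that the sums are finite, the next two that the two products over
prime ideals converge (unconditionally), and the last one is the asymptotic formula. -/
theorem theorem1p3 (K : Type*) [Field K] [NumberField K]
    [Algebra.IsQuadraticExtension ℚ K] [NumberField.IsTotallyComplex K]
    [IsPrincipalIdealRing (𝓞 K)] (σ : K →+* ℂ)
    (z : ℂ) (hz : z ≠ 0) (θ : ℝ) (hθ : 0 < θ) (hθ' : θ ≤ 2 * Real.pi) (k : 𝓞 K) :
    (∀ x : ℝ, (SectorialMirsky.sectorIntegers K σ z θ x).Finite) ∧
    Multipliable (SectorialMirsky.mainFactor K) ∧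
    Multipliable (fun 𝔭 : SectorialMirsky.PrimeDivisor K k =>
      SectorialMirsky.divisorFactor K 𝔭.1) ∧
    Asymptotics.IsEquivalent Filter.atTop
      (fun x : ℝ => ∑ᶠ a ∈ SectorialMirsky.sectorIntegers K σ z θ x,
        (SectorialMirsky.eulerPhiElem K a : ℝ) * (SectorialMirsky.eulerPhiElem K (a + k) : ℝ))
      (fun x : ℝ =>
        θ / (3 * Real.sqrt |(NumberField.discr K : ℝ)|) *
          (∏' 𝔭 : IsDedekindDomain.HeightOneSpectrum (𝓞 K), SectorialMirsky.mainFactor K 𝔭) *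
          (∏' 𝔭 : SectorialMirsky.PrimeDivisor K k, SectorialMirsky.divisorFactor K 𝔭.1) *
          x ^ 6) := by
  have hsum := SectorialMirsky.summable_inv_absNorm_sq (K := K) σ
  refine ⟨SectorialMirsky.finite_sectorIntegers σ hz θ,
    SectorialMirsky.multipliable_mainFactor hsum,
    SectorialMirsky.multipliable_divisorFactor hsum k, ?_⟩
  have key := SectorialMirsky.tendsto_sum_eulerPhi σ hz hθ hθ' k
    (SectorialMirsky.hasProd_localDensity hsum k)
  have hd : 0 < √|(NumberField.discr K : ℝ)| := by
    have : (NumberField.discr K : ℝ) ≠ 0 := by exact_mod_cast NumberField.discr_ne_zero K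
    positivity
  rw [← mul_assoc] at key
  set c := θ / (3 * √|(NumberField.discr K : ℝ)|) *
    (∏' 𝔭 : IsDedekindDomain.HeightOneSpectrum (𝓞 K), SectorialMirsky.mainFactor K 𝔭) *
    (∏' 𝔭 : SectorialMirsky.PrimeDivisor K k, SectorialMirsky.divisorFactor K 𝔭.1)
  have hc : c ≠ 0 := mul_ne_zero (mul_ne_zero (by positivity)
    (SectorialMirsky.tprod_mainFactor_ne_zero hsum))
    (SectorialMirsky.tprod_divisorFactor_ne_zero hsum k)
  rw [Asymptotics.isEquivalent_iff_tendsto_one]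
  · have h := key.div_const c
    rw [div_self hc] at h
    refine h.congr fun x => ?_
    rw [Pi.div_apply, finsum_mem_eq_finite_toFinset_sum _
      (SectorialMirsky.finite_sectorIntegers σ hz θ x), div_div, mul_comm c]
  · filter_upwards [Filter.eventually_gt_atTop 0] with x hx
    exact mul_ne_zero hc (by positivity)
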